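/- Write $\mathbb R_+=[0,\infty)$ and fix an integer $d>1$. Let $\nu$ be a $\sigma$-finite measure on $\mathbb R_+$ with $\nu(\mathbb R_+)=\infty$ and $\nu(\{0\})=0$. Let $g$ be a probability distribution on $\mathbb R_+$ and $\tau:\mathbb R_+\times\mathbb R_+\to\mathbb R_+$ a measurable function such that the image of $g(du)\,d\gamma$ under $\tau$, restricted to $(0,\infty)$, is $\nu$. Let $\Gamma_1<\Gamma_2<\cdots$ be the jump times of a unit-rate homogeneous Poisson process on $\mathbb R_+$ and, independently of it, let $U_1,U_2,\dots$ be i.i.d. with distribution $g$. Set $\theta_k=\tau(U_k,\Gamma_k)$, so that $(\theta_k)_{k\ge1}$ are the rates of a series representation of the completely random measure with rate measure $\nu$. For $i=(i_1,\dots,i_d)\in\mathbb N^d$ with distinct components put $\vartheta_i=\prod_{j=1}^d\theta_{i_j}$. For every $\vartheta\ge 0$ let $h(\cdot\mid\vartheta)$ be a probability distribution on $\{0,1,2,\dots\}$, depending measurably on $\vartheta$, with mean $\mu(\vartheta)=\sum_k k\,h(k\mid\vartheta)$ and $\pi(\vartheta)=h(0\mid\vartheta)$. Assume that $\pi(0)=1$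 and $$\int_{\mathbb R_+^d}\mu\Big(\prod_{j=1}^d\theta_j\Big)\prod_{j=1}^d\nu(d\theta_j)<\infty .$$ Let edges be generated by the independent likelihood process: given $(\theta_k)_{k\ge1}$, the counts $x_{ni}$ ($n=1,2,\dots$; $i\in\mathbb N^d$ with distinct components) are independent with $x_{ni}\sim h(\cdot\mid\vartheta_i)$. Let $x_i=\sum_{n=1}^N x_{ni}$ be the number of copies of edge $i$ after $N$ rounds, and let $I_N$ be the largest vertex index occurring in an edge $i$ with $x_i>0$ (with $I_N=0$ if there is no such edge, and $I_N=\infty$ if there is no largest index). For $K\ge d$ let $B_K=B_{K,1}+B_{K,2}+B_{K,3}\in[0,\infty]$, where, with $\tilde\theta=\prod_{j=1}^d\tau(U_j,\gamma_j)$, $d\gamma=\prod_{j=1}^d d\gamma_j$ and $-\log 0=\infty$, $$B_{K,1}=\mathbb E\Big[\int_{[\Gamma_K,\infty)^d}-\log\pi(\tilde\theta)\,d\gamma\Big],$$ $$B_{K,2}=\sum_{\ell=1}^{d-1}\binom d\ell\,\mathbb E\Big[\frac{(K-1)!}{(K-1-\ell)!}\,\Gamma_K^{-\ell}\int_{[0,\Gamma_K]^\ell\times[\Gamma_K,\infty)^{d-\ell}}-\log\pi(\tilde\theta)\,d\gamma\Big],$$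 $$B_{K,3}=\sum_{\ell=1}^{d-1}\ell\binom d\ell\,\mathbb E\Big[\frac{(K-1)!}{(K-\ell)!}\,\Gamma_K^{-(\ell-1)}\int_{[0,\Gamma_K]^\ell\times[\Gamma_K,\infty)^{d-\ell}}-\log\pi(\tilde\theta)\,\delta_{\gamma_\ell=\Gamma_K}\,d\gamma\Big];$$ in $B_{K,3}$ the Lebesgue measure in the coordinate $\gamma_\ell$ is replaced by the Dirac measure at $\Gamma_K$. Then: 1. For all integers $N\ge0$ and $K\ge d$, $\ \Pr(I_N\le K)\ \ge\ \exp(-N\,B_K)$ (with $0\cdot\infty=0$ and $e^{-\infty}=0$). 2. If $\int_{\mathbb R_+^d}-\log\pi\big(\prod_{j=1}^d\theta_j\big)\prod_{j=1}^d\nu(d\theta_j)<\infty$, then $B_K<\infty$ for every $K\ge d$. 3. If $B_K<\infty$ for some $K\ge d$ (in particular, in the situation of 2), then $\lim_{K\to\infty}B_K=0$. -/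

import Mathlib

open MeasureTheory ProbabilityTheory Filter Topology
open scoped NNReal ENNReal

namespace CRMNetwork

noncomputable section

/-- Lebesgue measure on `ℝ₊ = [0, ∞)`. -/
def lebesgue : Measure ℝ≥0 :=
  Measure.comap ((↑) : ℝ≥0 → ℝ) volume

/-- Lebesgue measure on `ℝ₊^d`. -/
def lebesguePi (d : ℕ) : Measure (Fin d → ℝ≥0) :=
  Measure.pi fun _ => lebesgue

/-- The pair `(g, τ)` gives a series representation of the completely random measure with rate
measure `ν`. Here `g` is the distribution of the marks, `τ : ℝ₊ × ℝ₊ → ℝ₊` is measurable, and the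
image of `g(du) dγ` under `τ`, restricted to the nonzero rates, is `ν`. (Rates equal to `0`, as
produced for instance by rejection, are not atoms.) -/
structure IsSeriesRepresentation (ν g : Measure ℝ≥0) (τ : ℝ≥0 → ℝ≥0 → ℝ≥0) : Prop where
  measurable : Measurable (Function.uncurry τ)
  map_eq : ((g.prod lebesgue).map (Function.uncurry τ)).restrict (Set.Ioi 0) = ν

/-- The `k`-th jump time `Γ_k` (`k = 1, 2, …`, and `Γ_0 = 0`) of the point process on `ℝ₊` whose
successive gaps are `E 0, E 1, …`. -/
def arrival {Ω : Type*} (E : ℕ → Ω → ℝ≥0) (k : ℕ) (ω : Ω) : ℝ≥0 :=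
  ∑ j ∈ Finset.range k, E j ω

/-- The random input of a series representation: `E` are the gaps of a unit-rate homogeneous
Poisson process on `ℝ₊` (i.i.d. standard exponential variables), and `U` is an i.i.d. sequence of
marks with distribution `g`, independent of that process. -/
structure IsPoissonWithMarks {Ω : Type*} [MeasurableSpace Ω] (P : Measure Ω) (g : Measure ℝ≥0)
    (E U : ℕ → Ω → ℝ≥0) : Prop where
  measurable_gap : ∀ k, Measurable (E k)
  measurable_mark : ∀ k, Measurable (U k)
  gap_law : ∀ k, P.map (fun ω => (E k ω : ℝ)) = expMeasure 1
  mark_law : ∀ k, P.map (U k) = g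
  indep : iIndepFun (Sum.elim E U) P

/-- The rates `θ_{k+1} = τ(U_{k+1}, Γ_{k+1})`. Vertices and marks are numbered from `0` here, so
that the vertex called `k` is the `(k+1)`-st one of the series. -/
def rate {Ω : Type*} (τ : ℝ≥0 → ℝ≥0 → ℝ≥0) (E U : ℕ → Ω → ℝ≥0) (k : ℕ) (ω : Ω) : ℝ≥0 :=
  τ (U k ω) (arrival E (k + 1) ω)

/-- The weight `ϑ_i = ∏_j θ_{i_j}` which the `d`-fold self-product gives to the multi-index `i`
with distinct components. -/
def edgeWeight {d : ℕ} (θ : ℕ → ℝ≥0) (i : Fin d ↪ ℕ) : ℝ≥0 :=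
  ∏ j, θ (i j)

/-- The mean `μ(ϑ) = ∑_k k h(k | ϑ)` of the likelihood `h`. -/
def likelihoodMean (h : Kernel ℝ≥0 ℕ) (ϑ : ℝ≥0) : ℝ≥0∞ :=
  ∫⁻ k, (k : ℝ≥0∞) ∂(h ϑ)

/-- `-log π(ϑ) ∈ [0, ∞]`, where `π(ϑ) = h(0 | ϑ)`; the value is `∞` if `π(ϑ) = 0`. -/
def negLogPi (h : Kernel ℝ≥0 ℕ) (ϑ : ℝ≥0) : ℝ≥0∞ :=
  (-ENNReal.log (h ϑ {0})).toENNReal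

/-- The independent likelihood process: conditionally on the rates `θ`, the counts `x n i` of the
edge `i` in round `n` are independent over all `n` and `i`, and `x n i` has distribution
`h(· | ϑ_i)`. This is expressed by the joint probabilities of finitely many counts and an
arbitrary event in the σ-algebra of the rates. -/
structure IsIndependentLikelihood {Ω : Type*} [MeasurableSpace Ω] (P : Measure Ω) {d : ℕ}
    (h : Kernel ℝ≥0 ℕ) (θ : ℕ → Ω → ℝ≥0) (x : ℕ → (Fin d ↪ ℕ) → Ω → ℕ) : Prop where
  measurable : ∀ n i, Measurable (x n i)
  cond_law : ∀ A : Set (ℕ → ℝ≥0), MeasurableSet A →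
    ∀ (F : Finset (ℕ × (Fin d ↪ ℕ))) (c : ℕ × (Fin d ↪ ℕ) → ℕ),
      P {ω | (fun k => θ k ω) ∈ A ∧ ∀ p ∈ F, x p.1 p.2 ω = c p} =
        ∫⁻ ω in {ω | (fun k => θ k ω) ∈ A},
          ∏ p ∈ F, h (edgeWeight (fun k => θ k ω) p.2) {c p} ∂P

/-- The number `x_i` of copies of the edge `i` after `N` rounds. -/
def edgeCount {Ω : Type*} {d : ℕ} (x : ℕ → (Fin d ↪ ℕ) → Ω → ℕ) (N : ℕ) (i : Fin d ↪ ℕ)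
    (ω : Ω) : ℕ :=
  ∑ n ∈ Finset.range N, x n i ω

/-- The maximal index `I_N` (counted from `1`) of a vertex in an edge that is present after `N`
rounds; it is `0` if there is no edge, and `∞` if there is no maximum. -/
def maxVertex {Ω : Type*} {d : ℕ} (x : ℕ → (Fin d ↪ ℕ) → Ω → ℕ) (N : ℕ) (ω : Ω) : ℕ∞ :=
  ⨆ (i : Fin d ↪ ℕ) (_ : 0 < edgeCount x N i ω) (j : Fin d), ((i j : ℕ∞) + 1)

/-- The region `[0, G]^ℓ × [G, ∞)^(d-ℓ)`. -/
def region (d ℓ : ℕ) (G : ℝ≥0) : Set (Fin d → ℝ≥0) :=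
  {γ | ∀ j : Fin d, if (j : ℕ) < ℓ then γ j ≤ G else G ≤ γ j}

/-- The measure `δ_{γ_ℓ = G} dγ` on `ℝ₊^d`: the `ℓ`-th coordinate (counted from `1`) carries the
Dirac measure at `G`, and all others carry Lebesgue measure. -/
def boundaryMeasure (d ℓ : ℕ) (G : ℝ≥0) : Measure (Fin d → ℝ≥0) :=
  Measure.pi fun j : Fin d => if (j : ℕ) + 1 = ℓ then Measure.dirac G else lebesgue

section Bound

variable {Ω : Type*} [MeasurableSpace Ω] (P : Measure Ω) (h : Kernel ℝ≥0 ℕ)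
  (τ : ℝ≥0 → ℝ≥0 → ℝ≥0) (E U : ℕ → Ω → ℝ≥0) (d K : ℕ)

/-- `-log π(θ̃)` with `θ̃ = ∏_{j=1}^d τ(U_j, γ_j)`. -/
def integrand (ω : Ω) (γ : Fin d → ℝ≥0) : ℝ≥0∞ :=
  negLogPi h (∏ j : Fin d, τ (U j ω) (γ j))

/-- `B_{K,1}`: all vertices in the tail. -/
def tailTerm : ℝ≥0∞ :=
  ∫⁻ ω, ∫⁻ γ in region d 0 (arrival E K ω), integrand h τ U d ω γ ∂(lebesguePi d) ∂P

/-- `B_{K,2}`: `ℓ` vertices in the truncation and `d - ℓ` in the tail. The descending factorial is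
`(K-1)! / (K-1-ℓ)!`. -/
def truncationTerm : ℝ≥0∞ :=
  ∑ ℓ ∈ Finset.Icc 1 (d - 1), (d.choose ℓ : ℝ≥0∞) *
    ∫⁻ ω, ((K - 1).descFactorial ℓ : ℝ≥0∞) * ((arrival E K ω : ℝ≥0∞) ^ ℓ)⁻¹ *
      ∫⁻ γ in region d ℓ (arrival E K ω), integrand h τ U d ω γ ∂(lebesguePi d) ∂P

/-- `B_{K,3}`: `ℓ - 1` vertices in the truncation, one on its boundary, `d - ℓ` in the tail. The
descending factorial is `(K-1)! / (K-ℓ)!`. -/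
def boundaryTerm : ℝ≥0∞ :=
  ∑ ℓ ∈ Finset.Icc 1 (d - 1), (ℓ : ℝ≥0∞) * (d.choose ℓ : ℝ≥0∞) *
    ∫⁻ ω, ((K - 1).descFactorial (ℓ - 1) : ℝ≥0∞) * ((arrival E K ω : ℝ≥0∞) ^ (ℓ - 1))⁻¹ *
      ∫⁻ γ in region d ℓ (arrival E K ω), integrand h τ U d ω γ
        ∂(boundaryMeasure d ℓ (arrival E K ω)) ∂P

/-- `B_K = B_{K,1} + B_{K,2} + B_{K,3} ∈ [0, ∞]`. -/
def truncationBound : ℝ≥0∞ :=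
  tailTerm P h τ E U d K + truncationTerm P h τ E U d K + boundaryTerm P h τ E U d K

end Bound

end

end CRMNetwork

/-!
Write `p_n(x) = e^{-x} xⁿ / n!` and `Q_k(x)` for the probability that a Poisson variable with mean
`x` is equal to `n`, resp. at least `k`; let `F(γ)` be the mean of `-log π(∏ⱼ τ(Uⱼ, γⱼ))` over the
marks, a symmetric function of the positions `γ ∈ ℝ₊^d`. The whole statement rests on the identity

  `B_K = ∑ E[-log π(ϑ_i)] = ∫ F(γ) Q_{K+1-d}(max γ) dγ`,

where the sum is over the edges `i` that have a vertex beyond the truncation at `K`.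

* The sum (`tsum_embedding_arrival`). By symmetry it is `d!` times the sum over increasing `i`. The
  increments of `Γ` along an increasing `i` are independent Erlang variables, so the binomial
  formula `∑ₐ p_a(x) p_{n-a}(y) = p_n(x + y)` shows, by induction on `d`, that the increasing
  tuples of points of which the last has the index `M` have the intensity `p_{M-d}(γ_d)`
  (`tsum_strictMono_arrival`). Summation over `M > K` gives the tail `Q_{K+1-d}`.
* The bound (`truncationBound_eq`). The law of `Γ_K` has the density `p_{K-1}`, and the factors
  `(K-1)! / (K-1-ℓ)! Γ_K^{-ℓ}` turn it into `p_{K-1-ℓ}`. The binomial coefficient counts the sets of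
  `ℓ` coordinates below the level `Γ_K`. So `B_K` is the integral of `F(γ)` against a weight which
  collects the levels between consecutive entries of `γ` (from `B_{K,1}` and `B_{K,2}`) and the
  levels equal to an entry (from `B_{K,3}`). As `Q_k' = p_{k-1}` and `Q_k - Q_{k+1} = p_k`, this
  weight telescopes to `Q_{K+1-d}(max γ)` (`lintegral_poissonWeight_add_sum`).

The first assertion is Jensen's inequality for the conditional probability
`∏ π(ϑ_i)^N = exp(N ∑ log π(ϑ_i))` that no edge beyond the truncation occurs, first for finitely
many edges, then by continuity from above (`exp_neg_tsum_le`). The second follows from `Q ≤ 1` and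
`∫ F dγ = ∫ -log π(∏ⱼ θⱼ) dν^d`, where rates equal to zero do not matter as `π(0) = 1`
(`lintegral_markIntegral`). The third is dominated convergence (`tendsto_truncationBound`).
-/

namespace CRMNetwork

/-! ### Lebesgue measure on the half-line and Poisson weights -/

lemma lintegral_lebesgue (φ : ℝ≥0 → ℝ≥0∞) :
    ∫⁻ x, φ x ∂lebesgue = ∫⁻ t in Set.Ici (0 : ℝ), φ t.toNNReal := by
  have hr : Set.range ((↑) : ℝ≥0 → ℝ) = Set.Ici 0 := by
    ext t; exact ⟨by rintro ⟨x, rfl⟩; exact x.2, fun ht => ⟨⟨t, ht⟩, rfl⟩⟩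
  have he : MeasurableEmbedding ((↑) : ℝ≥0 → ℝ) := .subtype_coe measurableSet_Ici
  rw [← hr, ← he.map_comap, he.lintegral_map]
  simp [lebesgue]

lemma lebesgue_Iic_lt_top (a : ℝ≥0) : lebesgue (Set.Iic a) < ∞ := by
  have he : MeasurableEmbedding ((↑) : ℝ≥0 → ℝ) := .subtype_coe measurableSet_Ici
  rw [lebesgue, he.comap_apply]
  refine (measure_mono (t := Set.Icc (0 : ℝ) a) ?_).trans_lt (by simp)
  rintro _ ⟨x, hx, rfl⟩
  exact ⟨x.2, hx⟩

instance sigmaFinite_lebesgue : SigmaFinite lebesgue :=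
  ⟨⟨{ set := fun n => Set.Iic n
      set_mem := fun _ => trivial
      finite := fun n => lebesgue_Iic_lt_top n
      spanning := Set.iUnion_eq_univ_iff.2 fun x => (exists_nat_ge x).imp fun _ h => h }⟩⟩

instance nullSingletonClass_lebesgue : NullSingletonClass lebesgue where
  measure_singleton x := by
    have he : MeasurableEmbedding ((↑) : ℝ≥0 → ℝ) := .subtype_coe measurableSet_Ici
    rw [lebesgue, he.comap_apply]; simp

instance sigmaFinite_lebesguePi (d : ℕ) : SigmaFinite (lebesguePi d) := by
  unfold lebesguePi; infer_instance

/-- Translation: `y ↦ a + y` carries Lebesgue measure on `ℝ₊` to Lebesgue measure on `[a, ∞)`. -/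
lemma lintegral_lebesgue_add (a : ℝ≥0) (φ : ℝ≥0 → ℝ≥0∞) :
    ∫⁻ y, φ (a + y) ∂lebesgue = ∫⁻ z, (Set.Ici a).indicator φ z ∂lebesgue := by
  rw [lintegral_lebesgue, lintegral_lebesgue, ← lintegral_indicator measurableSet_Ici,
    ← lintegral_indicator measurableSet_Ici,
    ← lintegral_add_left_eq_self
      (fun t => (Set.Ici (0 : ℝ)).indicator (fun t => (Set.Ici a).indicator φ t.toNNReal) t)
      (a : ℝ)]
  refine lintegral_congr fun t => ?_
  by_cases ht : 0 ≤ t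
  · have h1 : ((a : ℝ) + t).toNNReal = a + t.toNNReal := by
      rw [Real.toNNReal_add a.coe_nonneg ht]; simp
    have h2 : 0 ≤ (a : ℝ) + t := add_nonneg a.2 ht
    simp [Set.indicator, ht, h1, h2]
  · by_cases h2 : 0 ≤ (a : ℝ) + t
    · have : ¬ a ≤ ((a : ℝ) + t).toNNReal := by
        rw [Real.le_toNNReal_iff_coe_le h2]; simpa using ht
      simp [Set.indicator, ht, this]
    · simp [Set.indicator, ht, h2]

/-- The fundamental theorem of calculus for a nonnegative integrand and Lebesgue measure on
`ℝ₊`. -/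
lemma lintegral_Icc_ofReal {a b : ℝ≥0} (hab : a ≤ b) {f F : ℝ → ℝ} (hf : Continuous f)
    (hF : ∀ x, HasDerivAt F (f x) x) (h0 : ∀ x : ℝ, 0 ≤ x → x ≤ b → 0 ≤ f x) :
    ∫⁻ x in Set.Icc a b, ENNReal.ofReal (f x) ∂lebesgue = ENNReal.ofReal (F b - F a) := by
  have hab' : (a : ℝ) ≤ b := hab
  rw [← lintegral_indicator measurableSet_Icc, lintegral_lebesgue,
    ← intervalIntegral.integral_eq_sub_of_hasDerivAt (fun x _ => hF x)
      (hf.intervalIntegrable _ _), intervalIntegral.integral_of_le hab',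
    ← integral_Icc_eq_integral_Ioc,
    ofReal_integral_eq_lintegral_ofReal hf.continuousOn.integrableOn_Icc,
    ← lintegral_indicator measurableSet_Ici, ← lintegral_indicator measurableSet_Icc]
  · refine lintegral_congr fun t => ?_
    by_cases ht : 0 ≤ t
    · lift t to ℝ≥0 using ht
      simp [Set.indicator]
    · have : ¬ (a : ℝ) ≤ t := fun h => ht (a.2.trans h)
      simp [Set.indicator, ht, this]
  · exact (ae_restrict_iff' measurableSet_Icc).2
      (.of_forall fun (t : ℝ) ht => h0 t (a.2.trans ht.1) ht.2)

/-- The probability `e^{-x} xⁿ / n!` that a Poisson variable with mean `x` is equal to `n`. As a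
function of `x`, it is the density of the sum of `n + 1` independent standard exponentials. -/
noncomputable def poissonWeight (n : ℕ) (x : ℝ≥0) : ℝ≥0∞ :=
  ENNReal.ofReal (Real.exp (-x) * x ^ n / n.factorial)

/-- The probability that a Poisson variable with mean `x` is at least `k`. -/
noncomputable def poissonTail (k : ℕ) (x : ℝ≥0) : ℝ≥0∞ :=
  poissonMeasure x (Set.Ici k)

@[fun_prop]
lemma measurable_poissonWeight (n : ℕ) : Measurable (poissonWeight n) := by
  unfold poissonWeight; fun_prop

lemma poissonMeasure_singleton_eq (n : ℕ) (x : ℝ≥0) :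
    poissonMeasure x {n} = poissonWeight n x := by
  rw [poissonMeasure_singleton]; rfl

lemma poissonTail_eq_tsum (k : ℕ) (x : ℝ≥0) :
    poissonTail k x = ∑' n, if k ≤ n then poissonWeight n x else 0 := by
  rw [poissonTail, ← Measure.tsum_indicator_apply_singleton _ _ MeasurableSet.of_discrete]
  simp [Set.indicator, poissonMeasure_singleton_eq]

@[fun_prop]
lemma measurable_poissonTail (k : ℕ) : Measurable (poissonTail k) := by
  simp_rw [funext (poissonTail_eq_tsum k)]
  refine Measurable.tsum fun n => ?_
  split_ifs <;> fun_prop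

lemma poissonTail_le_one (k : ℕ) (x : ℝ≥0) : poissonTail k x ≤ 1 := prob_le_one

lemma poissonTail_anti {k l : ℕ} (h : k ≤ l) (x : ℝ≥0) : poissonTail l x ≤ poissonTail k x :=
  measure_mono (Set.Ici_subset_Ici.2 h)

lemma poissonTail_succ (k : ℕ) (x : ℝ≥0) :
    poissonWeight k x + poissonTail (k + 1) x = poissonTail k x := by
  rw [poissonTail, poissonTail, ← poissonMeasure_singleton_eq,
    ← measure_union (by simp) MeasurableSet.of_discrete]
  congr 1; ext n; simp; omega

lemma poissonTail_zero_right {k : ℕ} (hk : k ≠ 0) : poissonTail k 0 = 0 := by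
  rw [poissonTail_eq_tsum]
  refine ENNReal.tsum_eq_zero.2 fun n => ?_
  split_ifs with h
  · have : n ≠ 0 := by omega
    simp [poissonWeight, this]
  · rfl

lemma tendsto_poissonTail (x : ℝ≥0) : Tendsto (fun k => poissonTail k x) atTop (𝓝 0) := by
  have h := tendsto_measure_iInter_atTop (μ := poissonMeasure x) (s := fun k : ℕ => Set.Ici k)
    (fun _ => MeasurableSet.of_discrete.nullMeasurableSet)
    (fun _ _ h => Set.Ici_subset_Ici.2 h) ⟨0, measure_ne_top _ _⟩
  have : ⋂ k : ℕ, Set.Ici k = ∅ := by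
    ext n; simpa using ⟨n + 1, by omega⟩
  simp only [this, measure_empty] at h
  exact h

lemma poissonTail_eq_ofReal (k : ℕ) (x : ℝ≥0) : poissonTail k x =
    ENNReal.ofReal (1 - ∑ i ∈ Finset.range k, Real.exp (-x) * (x : ℝ) ^ i / i.factorial) := by
  have h : (Set.Ici k : Set ℕ) = (↑(Finset.range k))ᶜ := by ext; simp
  rw [poissonTail, h, prob_compl_eq_one_sub MeasurableSet.of_discrete,
    ← sum_measure_singleton, ENNReal.ofReal_sub _ (Finset.sum_nonneg fun i _ => by positivity),
    ENNReal.ofReal_one, ENNReal.ofReal_sum_of_nonneg fun i _ => by positivity]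
  simp [poissonMeasure_singleton_eq, poissonWeight]

lemma hasDerivAt_poissonTail (n : ℕ) (x : ℝ) :
    HasDerivAt (fun x : ℝ => 1 - ∑ i ∈ Finset.range (n + 1), Real.exp (-x) * x ^ i / i.factorial)
      (Real.exp (-x) * x ^ n / n.factorial) x := by
  have he : HasDerivAt (fun x : ℝ => Real.exp (-x)) (-Real.exp (-x)) x := by
    simpa using (hasDerivAt_neg x).exp
  induction n with
  | zero => simpa using he.const_sub 1
  | succ n ih =>
    have h1 := ih.sub ((he.mul (hasDerivAt_pow (n + 1) x)).div_const ((n + 1).factorial : ℝ))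
    refine (h1.congr_of_eventuallyEq (.of_forall fun y => ?_)).congr_deriv ?_
    · simp only [Finset.sum_range_succ _ (n + 1), Pi.mul_apply, Pi.sub_apply]; ring
    · rw [Nat.factorial_succ]; push_cast
      have : (n.factorial : ℝ) ≠ 0 := by positivity
      field_simp
      ring

/-- The derivative of the tail `k + 1` in the mean of the Poisson variable is the weight `k`. -/
lemma lintegral_poissonWeight_add_tail (n : ℕ) {a b : ℝ≥0} (hab : a ≤ b) :
    ∫⁻ x in Set.Icc a b, poissonWeight n x ∂lebesgue + poissonTail (n + 1) a =
      poissonTail (n + 1) b := by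
  have h := lintegral_Icc_ofReal hab (f := fun x => Real.exp (-x) * x ^ n / n.factorial)
    (by fun_prop) (hasDerivAt_poissonTail n) (fun x hx _ => by positivity)
  have hmono : MonotoneOn (fun x : ℝ => 1 - ∑ i ∈ Finset.range (n + 1),
      Real.exp (-x) * x ^ i / i.factorial) (Set.Ici 0) := by
    refine monotoneOn_of_deriv_nonneg (convex_Ici 0)
      (fun x _ => (hasDerivAt_poissonTail n x).continuousAt.continuousWithinAt)
      (fun x _ => (hasDerivAt_poissonTail n x).differentiableAt.differentiableWithinAt) ?_
    intro x hx
    rw [(hasDerivAt_poissonTail n x).deriv]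
    rw [interior_Ici] at hx
    have : 0 < x := hx
    positivity
  have ha := hmono (show (0 : ℝ) ∈ Set.Ici 0 by simp) (show (a : ℝ) ∈ Set.Ici 0 from a.2) a.2
  have h0 : (1 : ℝ) - ∑ i ∈ Finset.range (n + 1), Real.exp (-0) * 0 ^ i / i.factorial = 0 := by
    rw [Finset.sum_range_succ']; simp
  have hb := hmono (show (a : ℝ) ∈ Set.Ici 0 from a.2) (show (b : ℝ) ∈ Set.Ici 0 from b.2) hab
  simp only [h0] at ha
  rw [poissonTail_eq_ofReal, poissonTail_eq_ofReal]
  unfold poissonWeight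
  rw [h, ← ENNReal.ofReal_add (sub_nonneg.2 hb) ha]
  simp

/-- The convolution of the density `poissonWeight n` with the standard exponential density. -/
lemma lintegral_poissonWeight_conv_exp (n : ℕ) (z : ℝ≥0) :
    ∫⁻ x in Set.Iic z, poissonWeight n x * poissonWeight 0 (z - x) ∂lebesgue =
      poissonWeight (n + 1) z := by
  have h := lintegral_Icc_ofReal (zero_le : 0 ≤ z)
    (f := fun x => Real.exp (-z) * x ^ n / n.factorial)
    (F := fun x => Real.exp (-z) * x ^ (n + 1) / (n + 1).factorial)
    (by fun_prop) (fun x => by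
      refine (((hasDerivAt_pow (n + 1) x).const_mul (Real.exp (-z))).div_const
        ((n + 1).factorial : ℝ)).congr_deriv ?_
      have : (n.factorial : ℝ) ≠ 0 := by positivity
      rw [Nat.factorial_succ]; push_cast
      field_simp) (fun x hx _ => by positivity)
  have hI : Set.Icc 0 z = Set.Iic z := by ext; simp
  simp only [NNReal.coe_zero, ne_eq, Nat.add_eq_zero_iff, one_ne_zero, and_false, not_false_eq_true,
    zero_pow, mul_zero, zero_div, sub_zero, hI] at h
  rw [poissonWeight, ← h]
  refine setLIntegral_congr_fun measurableSet_Iic fun x hx => ?_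
  simp only [poissonWeight, pow_zero, Nat.factorial_zero, Nat.cast_one, div_one, mul_one]
  rw [← ENNReal.ofReal_mul (by positivity), NNReal.coe_sub hx]
  congr 1
  have : Real.exp (-(z : ℝ)) = Real.exp (-x) * Real.exp (-(z - x)) := by
    rw [← Real.exp_add]; congr 1; ring
  rw [this]; ring

/-- The sum of two independent Poisson variables is Poisson. -/
lemma sum_poissonWeight_mul (n : ℕ) (x y : ℝ≥0) :
    ∑ a ∈ Finset.range (n + 1), poissonWeight a x * poissonWeight (n - a) y =
      poissonWeight n (x + y) := by
  simp only [poissonWeight]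
  simp_rw [← ENNReal.ofReal_mul (show 0 ≤ Real.exp (-(x : ℝ)) * (x : ℝ) ^ _ / (_ : ℕ).factorial by
    positivity)]
  rw [← ENNReal.ofReal_sum_of_nonneg (fun i _ => by positivity)]
  congr 1
  push_cast
  rw [add_pow, Finset.mul_sum, Finset.sum_div]
  refine Finset.sum_congr rfl fun a ha => ?_
  have ha' : a ≤ n := by simpa [Nat.lt_succ_iff] using ha
  have h1 : (n.choose a : ℝ) = n.factorial / (a.factorial * (n - a).factorial) :=
    Nat.cast_choose ℝ ha'
  have h2 : Real.exp (-((x : ℝ) + y)) = Real.exp (-x) * Real.exp (-y) := by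
    rw [← Real.exp_add]; congr 1; ring
  rw [h1, h2]
  have : (n.factorial : ℝ) ≠ 0 := by positivity
  have : (a.factorial : ℝ) ≠ 0 := by positivity
  have : ((n - a).factorial : ℝ) ≠ 0 := by positivity
  field_simp

/-! ### Independence, and the law of sums of gaps -/

section

variable {Ω : Type*} [MeasurableSpace Ω] {P : Measure Ω}

lemma indepFun_of_measurable_iSup {ι β γ : Type*} [MeasurableSpace β] [MeasurableSpace γ]
    {X : ι → Ω → ℝ≥0} (hX : iIndepFun X P) (hm : ∀ i, Measurable (X i)) {S T : Set ι}
    (hST : Disjoint S T) {Y : Ω → β} {Z : Ω → γ}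
    (hY : Measurable[⨆ i ∈ S, MeasurableSpace.comap (X i) inferInstance] Y)
    (hZ : Measurable[⨆ i ∈ T, MeasurableSpace.comap (X i) inferInstance] Z) :
    IndepFun Y Z P := by
  rw [IndepFun_iff_Indep]
  exact indep_of_indep_of_le_left (indep_of_indep_of_le_right
    (indep_iSup_of_disjoint (fun i => (hm i).comap_le) hX hST) hZ.comap_le) hY.comap_le

lemma measurable_iSup_comap {Ω ι : Type*} (X : ι → Ω → ℝ≥0) {S : Set ι} {i : ι} (hi : i ∈ S) :
    Measurable[⨆ i ∈ S, MeasurableSpace.comap (X i) inferInstance] (X i) :=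
  (comap_measurable (X i)).mono (le_iSup₂_of_le i hi le_rfl) le_rfl

lemma lintegral_of_indepFun [IsProbabilityMeasure P] {β γ : Type*} [MeasurableSpace β]
    [MeasurableSpace γ]
    {Y : Ω → β} {Z : Ω → γ} (h : IndepFun Y Z P) (hY : Measurable Y) (hZ : Measurable Z)
    {φ : β × γ → ℝ≥0∞} (hφ : Measurable φ) :
    ∫⁻ ω, φ (Y ω, Z ω) ∂P = ∫⁻ ω, ∫⁻ z, φ (Y ω, z) ∂(P.map Z) ∂P := by
  have := Measure.isProbabilityMeasure_map (μ := P) hZ.aemeasurable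
  rw [← lintegral_map hφ (hY.prodMk hZ),
    (indepFun_iff_map_prod_eq_prod_map_map hY.aemeasurable hZ.aemeasurable).1 h,
    lintegral_prod _ hφ.aemeasurable, lintegral_map hφ.lintegral_prod_right' hY]

@[fun_prop]
lemma measurable_arrival {E : ℕ → Ω → ℝ≥0} (hE : ∀ k, Measurable (E k)) (k : ℕ) :
    Measurable (arrival E k) := by
  unfold arrival; fun_prop

/-- The `n`-th arrival is measurable for the `σ`-algebra generated by the first `n` gaps. -/
lemma measurable_arrival_iSup {Ω : Type*} (E U : ℕ → Ω → ℝ≥0) {S : Set (ℕ ⊕ ℕ)} {n : ℕ}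
    (hS : ∀ j < n, Sum.inl j ∈ S) :
    Measurable[⨆ i ∈ S, MeasurableSpace.comap (Sum.elim E U i) inferInstance] (arrival E n) := by
  refine @Finset.measurable_fun_sum _ _ _ _ _ _ (_) _ _ fun j hj => ?_
  exact measurable_iSup_comap (Sum.elim E U) (hS j (Finset.mem_range.1 hj))

namespace IsPoissonWithMarks

variable {g : Measure ℝ≥0} {E U : ℕ → Ω → ℝ≥0}

lemma measurable_elim (hEU : IsPoissonWithMarks P g E U) : ∀ i, Measurable (Sum.elim E U i) :=
  Sum.rec hEU.measurable_gap hEU.measurable_mark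

lemma map_gap (hEU : IsPoissonWithMarks P g E U) (k : ℕ) :
    P.map (E k) = lebesgue.withDensity (poissonWeight 0) := by
  refine Measure.ext_of_lintegral _ fun φ hφ => ?_
  have hm : Measurable fun ω => (E k ω : ℝ) := (hEU.measurable_gap k).coe_nnreal_real
  have h1 : ∫⁻ ω, φ (E k ω) ∂P = ∫⁻ t, φ t.toNNReal ∂(expMeasure 1) := by
    rw [← hEU.gap_law k, lintegral_map (by fun_prop) hm]; simp
  rw [lintegral_map hφ (hEU.measurable_gap k), h1,
    lintegral_withDensity_eq_lintegral_mul _ (by fun_prop) hφ, lintegral_lebesgue, expMeasure,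
    gammaMeasure, lintegral_withDensity_eq_lintegral_mul _
      (show Measurable (gammaPDF 1 1) from (measurable_gammaPDFReal 1 1).ennreal_ofReal)
      (by fun_prop),
    ← lintegral_indicator measurableSet_Ici]
  refine lintegral_congr fun t => ?_
  by_cases ht : 0 ≤ t
  · simp [gammaPDF_of_nonneg ht, poissonWeight, ht]
  · simp [gammaPDF_of_neg (not_le.1 ht), ht]

/-- The sum of `n + 1` consecutive gaps has the Erlang density `poissonWeight n`. -/
lemma map_sum_gap [IsProbabilityMeasure P] (hEU : IsPoissonWithMarks P g E U) (L n : ℕ) :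
    P.map (fun ω => ∑ j ∈ Finset.range (n + 1), E (L + j) ω) =
    lebesgue.withDensity (poissonWeight n) := by
  have hm := hEU.measurable_gap
  induction n with
  | zero => simpa using hEU.map_gap L
  | succ n ih =>
    refine Measure.ext_of_lintegral _ fun φ hφ => ?_
    have hind :
        IndepFun (fun ω => ∑ j ∈ Finset.range (n + 1), E (L + j) ω) (E (L + (n + 1))) P := by
      refine indepFun_of_measurable_iSup hEU.indep hEU.measurable_elim
        (S := {i | i ≠ Sum.inl (L + (n + 1))}) (T := {Sum.inl (L + (n + 1))}) (by simp) ?_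
        (measurable_iSup_comap (Sum.elim E U) (Set.mem_singleton _))
      refine @Finset.measurable_fun_sum _ _ _ _ _ _ (_) _ _ fun j hj => ?_
      refine measurable_iSup_comap (Sum.elim E U) (i := Sum.inl (L + j)) ?_
      simp at hj ⊢; omega
    rw [lintegral_map hφ (by fun_prop)]
    simp_rw [Finset.sum_range_succ _ (n + 1)]
    rw [lintegral_of_indepFun hind (by fun_prop) (hm _) (φ := fun p => φ (p.1 + p.2))
      (by fun_prop), hEU.map_gap]
    have hin (x : ℝ≥0) : ∫⁻ y, φ (x + y) ∂(lebesgue.withDensity (poissonWeight 0)) =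
        ∫⁻ z, (Set.Ici x).indicator (fun z => poissonWeight 0 (z - x) * φ z) z ∂lebesgue := by
      rw [lintegral_withDensity_eq_lintegral_mul _ (by fun_prop) (by fun_prop),
        ← lintegral_lebesgue_add]
      simp
    have hmeas : Measurable fun p : ℝ≥0 × ℝ≥0 =>
        (Set.Ici p.1).indicator (fun z => poissonWeight 0 (z - p.1) * φ z) p.2 := by
      have : MeasurableSet {p : ℝ≥0 × ℝ≥0 | p.1 ≤ p.2} :=
        measurableSet_le (by fun_prop) (by fun_prop)
      exact Measurable.indicator (s := {p : ℝ≥0 × ℝ≥0 | p.1 ≤ p.2})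
        (f := fun p => poissonWeight 0 (p.2 - p.1) * φ p.2) (by fun_prop) this
    simp_rw [hin]
    rw [← lintegral_map (f := fun x => ∫⁻ z, (Set.Ici x).indicator
        (fun z => poissonWeight 0 (z - x) * φ z) z ∂lebesgue) hmeas.lintegral_prod_right'
        (by fun_prop : Measurable fun ω => ∑ j ∈ Finset.range (n + 1), E (L + j) ω), ih,
      lintegral_withDensity_eq_lintegral_mul _ (by fun_prop) hmeas.lintegral_prod_right',
      lintegral_withDensity_eq_lintegral_mul _ (by fun_prop) hφ]
    simp only [Pi.mul_apply]
    have hc (x : ℝ≥0) : poissonWeight n x * ∫⁻ z, (Set.Ici x).indicator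
          (fun z => poissonWeight 0 (z - x) * φ z) z ∂lebesgue =
        ∫⁻ z, poissonWeight n x * (Set.Ici x).indicator
          (fun z => poissonWeight 0 (z - x) * φ z) z ∂lebesgue :=
      (lintegral_const_mul _ (hmeas.comp measurable_prodMk_left)).symm
    simp_rw [hc]
    rw [lintegral_lintegral_swap
      ((((measurable_poissonWeight n).comp measurable_fst).mul hmeas).aemeasurable)]
    refine lintegral_congr fun z => ?_
    rw [← lintegral_poissonWeight_conv_exp, ← lintegral_mul_const _ (by fun_prop),
      ← lintegral_indicator measurableSet_Iic]
    refine lintegral_congr fun x => ?_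
    by_cases hx : x ≤ z <;> simp [Set.indicator, hx, mul_assoc]

lemma map_arrival [IsProbabilityMeasure P] (hEU : IsPoissonWithMarks P g E U) (n : ℕ) :
    P.map (arrival E (n + 1)) =
    lebesgue.withDensity (poissonWeight n) := by
  have h := hEU.map_sum_gap 0 n
  simp only [zero_add] at h
  exact h

end IsPoissonWithMarks

lemma strictMono_snoc_iff {α : Type*} [Preorder α] {n : ℕ} (s : Fin (n + 1) → α) (m : α) :
    StrictMono (Fin.snoc s m : Fin (n + 2) → α) ↔ StrictMono s ∧ s (Fin.last n) < m := by
  rw [Fin.strictMono_iff_lt_succ, Fin.strictMono_iff_lt_succ, Fin.forall_fin_succ']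
  simp only [Fin.snoc_castSucc, Fin.succ_last, Fin.snoc_last, ← Fin.castSucc_succ]

lemma lintegral_lebesguePi_insertNth {d : ℕ} (j : Fin (d + 1)) {Φ : (Fin (d + 1) → ℝ≥0) → ℝ≥0∞}
    (hΦ : Measurable Φ) : ∫⁻ γ, Φ γ ∂(lebesguePi (d + 1)) =
      ∫⁻ G, ∫⁻ γ, Φ (j.insertNth G γ) ∂(lebesguePi d) ∂lebesgue := by
  have h := (measurePreserving_piFinSuccAbove (fun _ : Fin (d + 1) => lebesgue) j).symm
  rw [lebesguePi, ← h.lintegral_comp_emb (MeasurableEquiv.measurableEmbedding _),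
    lintegral_prod _ (by fun_prop)]
  rfl

lemma measurableSet_strictMono (d : ℕ) : MeasurableSet {γ : Fin d → ℝ≥0 | StrictMono γ} := by
  simp only [StrictMono, Set.ofPred_forall]
  exact .iInter fun i => .iInter fun j => .iInter fun _ =>
    measurableSet_lt (measurable_pi_apply i) (measurable_pi_apply j)

end

/-! ### Increasing chains of points of the Poisson process -/

section

variable {Ω : Type*} [MeasurableSpace Ω] {P : Measure Ω}

/-- Renewal at the last but one point of an increasing chain: the last point lies further by an
independent sum of gaps, which has an Erlang density. -/
lemma lintegral_snoc_arrival [IsProbabilityMeasure P] {g : Measure ℝ≥0} {E U : ℕ → Ω → ℝ≥0}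
    (hEU : IsPoissonWithMarks P g E U) {d : ℕ} {s : Fin (d + 1) → ℕ} (hs : StrictMono s) {M : ℕ}
    (hM : s (Fin.last d) < M) {Φ : (Fin (d + 2) → ℝ≥0) → ℝ≥0∞} (hΦ : Measurable Φ) :
    ∫⁻ ω, Φ (fun j => arrival E ((Fin.snoc s M : Fin (d + 2) → ℕ) j + 1) ω) ∂P =
      ∫⁻ ω, (fun γ : Fin (d + 1) → ℝ≥0 => ∫⁻ y, poissonWeight (M - 1 - s (Fin.last d)) y *
        Φ (Fin.snoc γ (γ (Fin.last d) + y)) ∂lebesgue) (fun j => arrival E (s j + 1) ω) ∂P := by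
  have hm := hEU.measurable_gap
  obtain ⟨n, rfl⟩ : ∃ n, M = s (Fin.last d) + 1 + n := ⟨_, (Nat.add_sub_cancel' hM).symm⟩
  set L := s (Fin.last d) with hL
  have hind : IndepFun (fun ω (j : Fin (d + 1)) => arrival E (s j + 1) ω)
      (fun ω => ∑ j ∈ Finset.range (n + 1), E (L + 1 + j) ω) P := by
    refine indepFun_of_measurable_iSup hEU.indep hEU.measurable_elim
      (S := Sum.inl '' Set.Iic L) (T := Sum.inl '' Set.Ioi L) ?_ ?_ ?_
    · exact (Set.disjoint_image_iff Sum.inl_injective).2 (Set.Iic_disjoint_Ioi le_rfl)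
    · refine @measurable_pi_lambda _ _ _ (_) _ _ fun j => ?_
      refine measurable_arrival_iSup E U fun i hi => ⟨i, ?_, rfl⟩
      have := hs.monotone (Fin.le_last j)
      simp only [Set.mem_Iic]; omega
    · refine @Finset.measurable_fun_sum _ _ _ _ _ _ (_) _ _ fun j hj => ?_
      exact measurable_iSup_comap (Sum.elim E U) (i := Sum.inl (L + 1 + j))
        ⟨L + 1 + j, Set.mem_Ioi.2 (by omega), rfl⟩
  have hsn : Measurable fun p : (Fin (d + 1) → ℝ≥0) × ℝ≥0 =>
      (Fin.snoc p.1 (p.1 (Fin.last d) + p.2) : Fin (d + 2) → ℝ≥0) := by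
    refine measurable_pi_lambda _ fun j => ?_
    refine Fin.lastCases ?_ (fun j => ?_) j
    · simp only [Fin.snoc_last]; fun_prop
    · simp only [Fin.snoc_castSucc]; fun_prop
  have hdec (ω : Ω) : (fun j => arrival E ((Fin.snoc s (L + 1 + n) : Fin (d + 2) → ℕ) j + 1) ω) =
      (Fin.snoc (fun j => arrival E (s j + 1) ω) (arrival E (L + 1) ω +
        ∑ j ∈ Finset.range (n + 1), E (L + 1 + j) ω) : Fin (d + 2) → ℝ≥0) := by
    funext j
    refine Fin.lastCases ?_ (fun j => ?_) j
    · simp only [Fin.snoc_last, arrival]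
      rw [show L + 1 + n + 1 = L + 1 + (n + 1) by omega, Finset.sum_range_add]
    · simp only [Fin.snoc_castSucc]
  simp_rw [hdec]
  have h := lintegral_of_indepFun hind (by fun_prop) (by fun_prop)
    (φ := fun p => Φ (Fin.snoc p.1 (p.1 (Fin.last d) + p.2))) (hΦ.comp hsn)
  rw [h, hEU.map_sum_gap]
  refine lintegral_congr fun ω => ?_
  have hφ : Measurable fun y => Φ (Fin.snoc (fun j : Fin (d + 1) => arrival E (s j + 1) ω)
      (arrival E (s (Fin.last d) + 1) ω + y)) := (hΦ.comp hsn).comp measurable_prodMk_left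
  have hn : L + 1 + n - 1 - L = n := by omega
  rw [hn]
  exact lintegral_withDensity_eq_lintegral_mul _ (measurable_poissonWeight n) hφ

lemma measurable_snoc {d : ℕ} : Measurable fun p : (Fin (d + 1) → ℝ≥0) × ℝ≥0 =>
    (Fin.snoc p.1 p.2 : Fin (d + 2) → ℝ≥0) := by
  refine measurable_pi_lambda _ fun j => ?_
  refine Fin.lastCases ?_ (fun j => ?_) j
  · simp only [Fin.snoc_last]; fun_prop
  · simp only [Fin.snoc_castSucc]; fun_prop

lemma tsum_fin_succ {d : ℕ} (f : (Fin (d + 1) → ℕ) → ℝ≥0∞) :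
    ∑' s, f s = ∑' (m : ℕ) (s : Fin d → ℕ), f (Fin.snoc s m) := by
  rw [← (Fin.snocEquiv fun _ => ℕ).tsum_eq, ← ENNReal.tsum_prod]
  rfl

/-- The sum over the index `L` of the last but one point of a chain of `d + 2` points, of which the
last has the index `M`. -/
lemma sum_range_poissonWeight_mul (d M : ℕ) (x y : ℝ≥0) :
    ∑ L ∈ Finset.range M, (if d ≤ L then poissonWeight (L - d) x else 0) *
      poissonWeight (M - 1 - L) y =
      if d + 1 ≤ M then poissonWeight (M - (d + 1)) (x + y) else 0 := by
  split_ifs with h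
  · obtain ⟨n, rfl⟩ := Nat.exists_eq_add_of_le h
    rw [show d + 1 + n = d + (n + 1) by omega, Finset.sum_range_add, Finset.sum_eq_zero,
      zero_add, show d + (n + 1) - (d + 1) = n by omega, ← sum_poissonWeight_mul]
    · refine Finset.sum_congr rfl fun a ha => ?_
      rw [if_pos (by omega)]
      congr 2 <;> omega
    · intro L hL
      rw [if_neg (by simpa using hL), zero_mul]
  · refine Finset.sum_eq_zero fun L hL => ?_
    rw [if_neg (by simp at hL; omega), zero_mul]

/-- The increasing chains of `d + 1` points of a unit-rate Poisson process whose last element is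
the point number `M` (counted from `0`) have the intensity `poissonWeight (M - d)` of the last
entry: this is the probability that exactly `M - d` further points lie below it. -/
theorem tsum_strictMono_arrival [IsProbabilityMeasure P] {g : Measure ℝ≥0} {E U : ℕ → Ω → ℝ≥0}
    (hEU : IsPoissonWithMarks P g E U) {d : ℕ} (M : ℕ) {Φ : (Fin (d + 1) → ℝ≥0) → ℝ≥0∞}
    (hΦ : Measurable Φ) :
    ∑' s : Fin (d + 1) → ℕ, {s | StrictMono s ∧ s (Fin.last d) = M}.indicator
        (fun s => ∫⁻ ω, Φ (fun j => arrival E (s j + 1) ω) ∂P) s =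
      ∫⁻ γ, {γ | StrictMono γ}.indicator (fun γ => (if d ≤ M then
        poissonWeight (M - d) (γ (Fin.last d)) else 0) * Φ γ) γ ∂(lebesguePi (d + 1)) := by
  classical
  induction d generalizing M with
  | zero =>
    have hsub : Subsingleton (Fin (0 + 1)) := inferInstanceAs (Subsingleton (Fin 1))
    rw [tsum_eq_single (fun _ => M) (fun s hs => Set.indicator_of_notMem ?_ _)]
    · rw [Set.indicator_of_mem (by exact ⟨Subsingleton.strictMono _, rfl⟩),
        ← lintegral_map (f := fun x => Φ fun _ => x) (by fun_prop)
          (measurable_arrival hEU.measurable_gap _), hEU.map_arrival,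
        lintegral_withDensity_eq_lintegral_mul _ (by fun_prop) (by fun_prop),
        lintegral_lebesguePi_insertNth 0]
      · refine lintegral_congr fun x => ?_
        have hx (γ : Fin 0 → ℝ≥0) : (Fin.insertNth 0 x γ : Fin (0 + 1) → ℝ≥0) = fun _ => x :=
          funext fun j => by rw [Subsingleton.elim j 0, Fin.insertNth_apply_same]
        simp_rw [hx]
        rw [lintegral_const, Set.indicator_of_mem (by exact Subsingleton.strictMono _)]
        simp [lebesguePi]
      · refine Measurable.indicator ?_ (measurableSet_strictMono _)
        split_ifs <;> fun_prop
    · rintro ⟨-, h⟩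
      exact hs (funext fun j => by rw [← h, Subsingleton.elim j])
  | succ d ih =>
    have hmeasΦ (k : ℕ) : Measurable fun p : (Fin (d + 1) → ℝ≥0) × ℝ≥0 => poissonWeight k p.2 *
        Φ (Fin.snoc p.1 (p.1 (Fin.last d) + p.2)) :=
      ((measurable_poissonWeight k).comp measurable_snd).mul (hΦ.comp (measurable_snoc.comp
        (measurable_fst.prodMk (((measurable_pi_apply _).comp measurable_fst).add measurable_snd))))
    -- split off the last entry of the chain and sum over the value `L` of the last but one
    have h1 : ∑' s : Fin (d + 2) → ℕ, {s | StrictMono s ∧ s (Fin.last (d + 1)) = M}.indicator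
          (fun s => ∫⁻ ω, Φ (fun j => arrival E (s j + 1) ω) ∂P) s =
        ∑ L ∈ Finset.range M, ∑' s : Fin (d + 1) → ℕ,
          {s | StrictMono s ∧ s (Fin.last d) = L}.indicator (fun s => ∫⁻ ω,
            (fun γ : Fin (d + 1) → ℝ≥0 => ∫⁻ y, poissonWeight (M - 1 - L) y *
              Φ (Fin.snoc γ (γ (Fin.last d) + y)) ∂lebesgue)
                (fun j => arrival E (s j + 1) ω) ∂P) s := by
      rw [tsum_fin_succ, tsum_eq_single M, ← (Summable.tsum_finsetSum fun _ _ => ENNReal.summable)]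
      · refine tsum_congr fun s => ?_
        by_cases hs : StrictMono s
        · by_cases hsM : s (Fin.last d) < M
          · rw [Finset.sum_eq_single_of_mem _ (Finset.mem_range.2 hsM),
              Set.indicator_of_mem (show s ∈ {s' : Fin (d + 1) → ℕ | StrictMono s' ∧
                s' (Fin.last d) = s (Fin.last d)} from ⟨hs, rfl⟩), Set.indicator_of_mem]
            · exact lintegral_snoc_arrival hEU hs hsM hΦ
            · exact ⟨(strictMono_snoc_iff _ _).2 ⟨hs, hsM⟩, Fin.snoc_last _ _⟩
            · exact fun L _ hL => Set.indicator_of_notMem (fun h => hL h.2.symm) _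
          · rw [Finset.sum_eq_zero, Set.indicator_of_notMem]
            · exact fun h => hsM ((strictMono_snoc_iff _ _).1 h.1).2
            · intro L hL
              refine Set.indicator_of_notMem (fun h => hsM ?_) _
              rw [h.2]; exact Finset.mem_range.1 hL
        · rw [Finset.sum_eq_zero, Set.indicator_of_notMem]
          · exact fun h => hs ((strictMono_snoc_iff _ _).1 h.1).1
          · exact fun L hL => Set.indicator_of_notMem (fun h => hs h.1) _
      · intro m hm
        refine ENNReal.tsum_eq_zero.2 fun s => Set.indicator_of_notMem (fun h => hm ?_) _
        exact (Fin.snoc_last (α := fun _ => ℕ) m s).symm.trans h.2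
    rw [h1, Finset.sum_congr rfl fun L _ => ih L (hmeasΦ (M - 1 - L)).lintegral_prod_right']
    have hw (L : ℕ) : Measurable fun x => if d ≤ L then poissonWeight (L - d) x else 0 := by
      split_ifs <;> fun_prop
    have hmL (L : ℕ) : Measurable fun γ : Fin (d + 1) → ℝ≥0 => {γ | StrictMono γ}.indicator
        (fun γ => (if d ≤ L then poissonWeight (L - d) (γ (Fin.last d)) else 0) *
          ∫⁻ y, poissonWeight (M - 1 - L) y * Φ (Fin.snoc γ (γ (Fin.last d) + y)) ∂lebesgue) γ :=
      Measurable.indicator (((hw L).comp (measurable_pi_apply (Fin.last d))).mul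
        (hmeasΦ (M - 1 - L)).lintegral_prod_right') (measurableSet_strictMono _)
    rw [← lintegral_finsetSum _ fun L _ => hmL L,
      lintegral_lebesguePi_insertNth (Fin.last (d + 1))]
    swap
    · refine Measurable.indicator ?_ (measurableSet_strictMono _)
      split_ifs <;> fun_prop
    rw [lintegral_lintegral_swap]
    swap
    · simp only [Fin.insertNth_last']
      refine Measurable.aemeasurable ((?_ : Measurable _).comp
        (measurable_snoc.comp measurable_swap))
      refine Measurable.indicator ?_ (measurableSet_strictMono _)
      split_ifs <;> fun_prop
    refine lintegral_congr fun γ => ?_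
    by_cases hγ : StrictMono γ
    swap
    · rw [Finset.sum_eq_zero fun L _ => Set.indicator_of_notMem hγ _]
      refine (lintegral_eq_zero_of_ae_eq_zero (.of_forall fun z => ?_)).symm
      refine Set.indicator_of_notMem (fun h => hγ ?_) _
      rw [Set.mem_ofPred_eq, Fin.insertNth_last'] at h
      exact ((strictMono_snoc_iff _ _).1 h).1
    -- in terms of the last position `z = a + y` the two weights convolve
    set a := γ (Fin.last d) with ha
    have h2 (L : ℕ) : ∫⁻ y, poissonWeight (M - 1 - L) y * Φ (Fin.snoc γ (a + y)) ∂lebesgue =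
        ∫⁻ z, (Set.Ici a).indicator (fun z => poissonWeight (M - 1 - L) (z - a) *
          Φ (Fin.snoc γ z)) z ∂lebesgue := by
      rw [← lintegral_lebesgue_add]; simp
    have hmz (L : ℕ) : Measurable fun z => (Set.Ici a).indicator (fun z =>
        poissonWeight (M - 1 - L) (z - a) * Φ (Fin.snoc γ z)) z :=
      Measurable.indicator (((measurable_poissonWeight _).comp (by fun_prop)).mul
        (hΦ.comp (measurable_snoc.comp measurable_prodMk_left))) measurableSet_Ici
    simp_rw [Set.indicator_of_mem (show γ ∈ {γ | StrictMono γ} from hγ), ← ha, h2,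
      ← lintegral_const_mul _ (hmz _)]
    rw [← lintegral_finsetSum _ fun L _ => (hmz L).const_mul _]
    refine lintegral_congr_ae ?_
    have hne : ∀ᵐ z ∂lebesgue, z ≠ a := by simp [ae_iff]
    filter_upwards [hne] with z hz
    have hsm : (Fin.snoc γ z : Fin (d + 2) → ℝ≥0) ∈ {γ | StrictMono γ} ↔ z ∈ Set.Ici a := by
      rw [Set.mem_ofPred_eq, strictMono_snoc_iff, and_iff_right hγ, ← ha]
      exact ⟨le_of_lt, fun h => lt_of_le_of_ne h hz.symm⟩
    rw [Fin.insertNth_last']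
    by_cases hza : z ∈ Set.Ici a
    · simp only [Set.indicator_of_mem hza, ← mul_assoc, ← Finset.sum_mul,
        sum_range_poissonWeight_mul, add_tsub_cancel_of_le (Set.mem_Ici.1 hza)]
      rw [Set.indicator_of_mem (hsm.2 hza), Fin.snoc_last]
    · rw [Set.indicator_of_notMem fun h => hza (hsm.1 h)]
      simp [Set.indicator_of_notMem hza]

end

/-! ### Symmetrization over the orderings of the points -/

/-- Exactly one rearrangement of an injective tuple is strictly increasing. -/
lemma sum_perm_indicator_strictMono {α : Type*} [LinearOrder α] {d : ℕ} (f : (Fin d → α) → ℝ≥0∞)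
    (γ : Fin d → α) :
    ∑ σ : Equiv.Perm (Fin d), {γ : Fin d → α | StrictMono (γ ∘ σ)}.indicator f γ =
      {γ : Fin d → α | Function.Injective γ}.indicator f γ := by
  by_cases h : Function.Injective γ
  · rw [Finset.sum_eq_single (Tuple.sort γ)]
    · rw [Set.indicator_of_mem, Set.indicator_of_mem (by exact h)]
      exact (Tuple.monotone_sort γ).strictMono_of_injective (h.comp (Tuple.sort γ).injective)
    · intro σ _ hσ
      refine Set.indicator_of_notMem (fun hm => hσ ?_) _
      have := Tuple.unique_monotone (StrictMono.monotone hm) (Tuple.monotone_sort γ)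
      exact Equiv.ext fun j => h (congrFun this j)
    · simp
  · rw [Set.indicator_of_notMem (by exact h)]
    refine Finset.sum_eq_zero fun σ _ => Set.indicator_of_notMem (fun hm => h ?_) _
    have := (StrictMono.injective hm).comp σ.symm.injective
    rwa [Function.comp_assoc, Equiv.self_comp_symm, Function.comp_id] at this

/-- Rearrangement of a sum over all multi-indices with distinct components. -/
lemma tsum_embedding_eq {d : ℕ} {f : (Fin d → ℕ) → ℝ≥0∞}
    (hf : ∀ (σ : Equiv.Perm (Fin d)) s, f (s ∘ σ) = f s) :
    ∑' i : Fin d ↪ ℕ, f i = (d.factorial : ℝ≥0∞) *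
      ∑' s, {s : Fin d → ℕ | StrictMono s}.indicator f s := by
  rw [← (Equiv.subtypeInjectiveEquivEmbedding (Fin d) ℕ).tsum_eq]
  have h1 : ∑' c : {f : Fin d → ℕ // Function.Injective f},
      f ((Equiv.subtypeInjectiveEquivEmbedding (Fin d) ℕ) c) =
      ∑' s, {s : Fin d → ℕ | Function.Injective s}.indicator f s :=
    tsum_subtype {s : Fin d → ℕ | Function.Injective s} f
  rw [h1]
  simp_rw [← sum_perm_indicator_strictMono]
  rw [Summable.tsum_finsetSum fun _ _ => ENNReal.summable]
  have h2 (σ : Equiv.Perm (Fin d)) :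
      ∑' s, {s : Fin d → ℕ | StrictMono (s ∘ σ)}.indicator f s =
        ∑' s, {s : Fin d → ℕ | StrictMono s}.indicator f s := by
    rw [← (σ.arrowCongr (Equiv.refl ℕ)).symm.tsum_eq
      ({s : Fin d → ℕ | StrictMono s}.indicator f)]
    refine tsum_congr fun s => ?_
    rw [show (σ.arrowCongr (Equiv.refl ℕ)).symm s = s ∘ σ from rfl]
    simp [Set.indicator, hf]
  simp [h2, Fintype.card_perm]

lemma ae_injective_lebesguePi (d : ℕ) :
    ∀ᵐ γ ∂(lebesguePi (d + 1)), Function.Injective γ := by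
  have h (j : Fin (d + 1)) (k : Fin d) : ∀ᵐ γ ∂(lebesguePi (d + 1)), γ j ≠ γ (j.succAbove k) := by
    have hm : MeasurableSet {γ : Fin (d + 1) → ℝ≥0 | γ j = γ (j.succAbove k)} :=
      measurableSet_eq_fun (by fun_prop) (by fun_prop)
    rw [ae_iff]
    simp only [ne_eq, not_not]
    rw [← lintegral_indicator_one hm, lintegral_lebesguePi_insertNth j
      (measurable_one.indicator hm)]
    refine (lintegral_congr fun G => ?_).trans lintegral_zero
    have h0 : lebesguePi d {γ | γ k = G} = 0 :=
      Measure.pi_hyperplane (fun _ : Fin d => lebesgue) k G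
    have hmk : MeasurableSet {γ : Fin d → ℝ≥0 | γ k = G} :=
      measurableSet_eq_fun (by fun_prop) (by fun_prop)
    rw [← h0, ← lintegral_indicator_one hmk]
    refine lintegral_congr fun γ => ?_
    simp [Set.indicator, eq_comm]
  filter_upwards [ae_all_iff.2 fun j => ae_all_iff.2 (h j)] with γ hγ j k hjk
  by_contra hne
  obtain ⟨k, rfl⟩ := Fin.exists_succAbove_eq (Ne.symm hne)
  exact hγ j k hjk

lemma lintegral_pi_comp_perm {α : Type*} [MeasurableSpace α] (μ : Measure α) [SigmaFinite μ]
    {d : ℕ} (σ : Equiv.Perm (Fin d)) (f : (Fin d → α) → ℝ≥0∞) :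
    ∫⁻ γ, f (γ ∘ σ) ∂(Measure.pi fun _ => μ) = ∫⁻ γ, f γ ∂(Measure.pi fun _ => μ) := by
  have h := measurePreserving_piCongrLeft (fun _ : Fin d => μ) σ.symm
  have h2 := h.lintegral_comp_emb (MeasurableEquiv.measurableEmbedding _) f
  rw [← h2]
  refine lintegral_congr fun γ => congrArg f (funext fun j => ?_)
  have := MeasurableEquiv.piCongrLeft_apply_apply σ.symm (β := fun _ : Fin d => α) γ (σ j)
  simpa using this.symm

lemma lintegral_lebesguePi_comp_perm {d : ℕ} (σ : Equiv.Perm (Fin d))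
    (f : (Fin d → ℝ≥0) → ℝ≥0∞) :
    ∫⁻ γ, f (γ ∘ σ) ∂(lebesguePi d) = ∫⁻ γ, f γ ∂(lebesguePi d) :=
  lintegral_pi_comp_perm lebesgue σ f

/-- The integral of a symmetric function over `ℝ₊^d` is `d!` times that over the increasing
chamber. -/
lemma lintegral_eq_factorial_mul_strictMono {d : ℕ} {f : (Fin (d + 1) → ℝ≥0) → ℝ≥0∞}
    (hfm : Measurable f) (hf : ∀ (σ : Equiv.Perm (Fin (d + 1))) γ, f (γ ∘ σ) = f γ) :
    ∫⁻ γ, f γ ∂(lebesguePi (d + 1)) = ((d + 1).factorial : ℝ≥0∞) *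
      ∫⁻ γ, {γ | StrictMono γ}.indicator f γ ∂(lebesguePi (d + 1)) := by
  have h1 : ∫⁻ γ, f γ ∂(lebesguePi (d + 1)) = ∫⁻ γ, ∑ σ : Equiv.Perm (Fin (d + 1)),
      {γ : Fin (d + 1) → ℝ≥0 | StrictMono (γ ∘ σ)}.indicator f γ ∂(lebesguePi (d + 1)) := by
    refine lintegral_congr_ae ?_
    filter_upwards [ae_injective_lebesguePi d] with γ hγ
    rw [sum_perm_indicator_strictMono, Set.indicator_of_mem (by exact hγ)]
  have hm (σ : Equiv.Perm (Fin (d + 1))) : Measurable fun γ : Fin (d + 1) → ℝ≥0 => γ ∘ σ :=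
    measurable_pi_lambda _ fun j => measurable_pi_apply _
  have hmS (σ : Equiv.Perm (Fin (d + 1))) :
      MeasurableSet {γ : Fin (d + 1) → ℝ≥0 | StrictMono (γ ∘ σ)} :=
    hm σ (measurableSet_strictMono _)
  rw [h1, lintegral_finsetSum _ fun σ _ => hfm.indicator (hmS σ)]
  have h2 (σ : Equiv.Perm (Fin (d + 1))) : ∫⁻ γ, {γ : Fin (d + 1) → ℝ≥0 |
      StrictMono (γ ∘ σ)}.indicator f γ ∂(lebesguePi (d + 1)) =
      ∫⁻ γ, {γ | StrictMono γ}.indicator f γ ∂(lebesguePi (d + 1)) := by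
    rw [← lintegral_lebesguePi_comp_perm σ ({γ | StrictMono γ}.indicator f)]
    refine lintegral_congr fun γ => ?_
    simp [Set.indicator, hf]
  simp [h2, Fintype.card_perm]

lemma sup_univ_comp_perm {α : Type*} [SemilatticeSup α] [OrderBot α] {d : ℕ}
    (σ : Equiv.Perm (Fin d)) (γ : Fin d → α) :
    Finset.univ.sup (γ ∘ σ) = Finset.univ.sup γ := by
  have h := Finset.sup_map Finset.univ σ.toEmbedding γ
  rw [Finset.map_univ_equiv] at h
  exact h.symm

lemma sup_univ_of_strictMono {α : Type*} [LinearOrder α] [OrderBot α] {d : ℕ}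
    {γ : Fin (d + 1) → α} (h : StrictMono γ) : Finset.univ.sup γ = γ (Fin.last d) :=
  le_antisymm (Finset.sup_le fun j _ => h.monotone (Fin.le_last j))
    (Finset.le_sup (Finset.mem_univ _))

lemma tsum_poissonWeight_sub {d K : ℕ} (hK : d ≤ K) (x : ℝ≥0) :
    ∑' M, (if K ≤ M then if d ≤ M then poissonWeight (M - d) x else 0 else 0) =
      poissonTail (K - d) x := by
  rw [poissonTail_eq_tsum, ← (add_left_injective d).tsum_eq]
  · refine tsum_congr fun n => ?_
    simp only [Nat.add_sub_cancel, Nat.le_add_left, if_true, Nat.sub_le_iff_le_add]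
  · intro M hM
    refine ⟨M - d, Nat.sub_add_cancel (hK.trans ?_)⟩
    by_contra h
    exact hM (if_neg h)

@[fun_prop]
lemma measurable_sup_univ (d : ℕ) :
    Measurable fun γ : Fin (d + 1) → ℝ≥0 => Finset.univ.sup γ := by
  simp_rw [← Finset.sup'_eq_sup Finset.univ_nonempty]
  have h := Finset.measurable_sup' (f := fun (j : Fin (d + 1)) (γ : Fin (d + 1) → ℝ≥0) => γ j)
    Finset.univ_nonempty (fun j _ => measurable_pi_apply j)
  convert h using 2 with γ
  rw [Finset.sup'_apply]

/-- The multi-indices of distinct points of a unit-rate Poisson process some entry of which is at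
least `K`: such a multi-index contributes iff at least `K - d` further points lie below its
largest point. -/
theorem tsum_embedding_arrival {Ω : Type*} [MeasurableSpace Ω] {P : Measure Ω}
    [IsProbabilityMeasure P] {g : Measure ℝ≥0} {E U : ℕ → Ω → ℝ≥0}
    (hEU : IsPoissonWithMarks P g E U) {d K : ℕ} (hK : d ≤ K) {F : (Fin (d + 1) → ℝ≥0) → ℝ≥0∞}
    (hF : Measurable F) (hsymm : ∀ (σ : Equiv.Perm (Fin (d + 1))) γ, F (γ ∘ σ) = F γ) :
    ∑' i : Fin (d + 1) ↪ ℕ, {s : Fin (d + 1) → ℕ | ∃ j, K ≤ s j}.indicator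
        (fun s => ∫⁻ ω, F (fun j => arrival E (s j + 1) ω) ∂P) i =
      ∫⁻ γ, poissonTail (K - d) (Finset.univ.sup γ) * F γ ∂(lebesguePi (d + 1)) := by
  have hK' {s : Fin (d + 1) → ℕ} (hs : StrictMono s) :
      s ∈ {s : Fin (d + 1) → ℕ | ∃ j, K ≤ s j} ↔ K ≤ s (Fin.last d) :=
    ⟨fun ⟨j, hj⟩ => hj.trans (hs.monotone (Fin.le_last j)), fun h => ⟨_, h⟩⟩
  rw [tsum_embedding_eq, lintegral_eq_factorial_mul_strictMono
    (f := fun γ => poissonTail (K - d) (Finset.univ.sup γ) * F γ) (by fun_prop) fun σ γ => by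
      rw [sup_univ_comp_perm, hsymm]]
  · congr 1
    have h1 : ∀ s : Fin (d + 1) → ℕ, {s | StrictMono s}.indicator
        ({s : Fin (d + 1) → ℕ | ∃ j, K ≤ s j}.indicator
          fun s => ∫⁻ ω, F (fun j => arrival E (s j + 1) ω) ∂P) s =
        ∑' M, if K ≤ M then {s | StrictMono s ∧ s (Fin.last d) = M}.indicator
          (fun s => ∫⁻ ω, F (fun j => arrival E (s j + 1) ω) ∂P) s else 0 := by
      intro s
      rw [tsum_eq_single (s (Fin.last d))]
      · by_cases hs : StrictMono s
        · simp only [Set.indicator, hK' hs, Set.mem_ofPred_eq, hs, if_true, and_self]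
        · simp [Set.indicator, hs]
      · intro M hM
        rw [Set.indicator_of_notMem fun h => hM h.2.symm, ite_self]
    simp_rw [h1]
    rw [ENNReal.tsum_comm]
    have h2 (M : ℕ) : ∑' s : Fin (d + 1) → ℕ,
        (if K ≤ M then {s | StrictMono s ∧ s (Fin.last d) = M}.indicator
          (fun s => ∫⁻ ω, F (fun j => arrival E (s j + 1) ω) ∂P) s else 0) =
        ∫⁻ γ, {γ | StrictMono γ}.indicator (fun γ => (if K ≤ M then if d ≤ M then
          poissonWeight (M - d) (γ (Fin.last d)) else 0 else 0) * F γ) γ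
          ∂(lebesguePi (d + 1)) := by
      by_cases hM : K ≤ M
      · simp only [hM, if_true]
        exact tsum_strictMono_arrival hEU M hF
      · simp [hM]
    simp_rw [h2]
    rw [← lintegral_tsum]
    · refine lintegral_congr fun γ => ?_
      by_cases hγ : γ ∈ {γ : Fin (d + 1) → ℝ≥0 | StrictMono γ}
      · simp_rw [Set.indicator_of_mem hγ, ENNReal.tsum_mul_right,
          tsum_poissonWeight_sub hK, sup_univ_of_strictMono hγ]
      · simp_rw [Set.indicator_of_notMem hγ, tsum_zero]
    · refine fun M => (Measurable.indicator ?_ (measurableSet_strictMono _)).aemeasurable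
      split_ifs <;> fun_prop
  · intro σ s
    have hex : (∃ j, K ≤ (s ∘ σ) j) ↔ ∃ j, K ≤ s j := 
      ⟨fun ⟨j, h⟩ => ⟨σ j, h⟩, fun ⟨j, h⟩ => ⟨σ.symm j, by simpa using h⟩⟩
    simp only [Set.indicator, Set.mem_ofPred_eq, hex]
    split_ifs
    · exact lintegral_congr fun ω => hsymm σ fun j => arrival E (s j + 1) ω
    · rfl

/-! ### Cuts of the positions at a level -/

/-- The region in which exactly the coordinates in `S` lie below the level `G`, up to ties. -/
def cutRegion {d : ℕ} (S : Finset (Fin d)) (G : ℝ≥0) : Set (Fin d → ℝ≥0) :=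
  {γ | ∀ j, if j ∈ S then γ j ≤ G else G ≤ γ j}

lemma region_eq_cutRegion (d ℓ : ℕ) (G : ℝ≥0) :
    region d ℓ G = cutRegion (Finset.univ.filter fun j : Fin d => (j : ℕ) < ℓ) G := by
  simp [region, cutRegion]

lemma measurableSet_cutRegion {d : ℕ} (S : Finset (Fin d)) :
    MeasurableSet {q : ℝ≥0 × (Fin d → ℝ≥0) | q.2 ∈ cutRegion S q.1} := by
  have h : {q : ℝ≥0 × (Fin d → ℝ≥0) | q.2 ∈ cutRegion S q.1} =
      ⋂ j, {q : ℝ≥0 × (Fin d → ℝ≥0) | if j ∈ S then q.2 j ≤ q.1 else q.1 ≤ q.2 j} := by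
    ext; simp [cutRegion]
  rw [h]
  refine .iInter fun j => ?_
  split_ifs
  · exact measurableSet_le (by fun_prop) (by fun_prop)
  · exact measurableSet_le (by fun_prop) (by fun_prop)

/-- A permutation that carries an initial segment onto `S`. -/
lemma exists_perm_mem_iff_lt {d : ℕ} (S : Finset (Fin d)) :
    ∃ σ : Equiv.Perm (Fin d), ∀ j, σ j ∈ S ↔ (j : ℕ) < S.card := by
  have hcard : Fintype.card {j : Fin d // (j : ℕ) < S.card} = Fintype.card {j // j ∈ S} := by
    have := S.card_le_univ
    rw [Fintype.card_fin] at this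
    rw [Fintype.card_subtype, Fintype.card_coe]
    simp [Fin.card_filter_val_lt, this]
  let e := Fintype.equivOfCardEq hcard
  refine ⟨e.extendSubtype, fun j => ⟨fun h => ?_, e.extendSubtype_mem j⟩⟩
  by_contra hj
  exact e.extendSubtype_not_mem j hj h

/-- A permutation that carries an initial segment onto `S` and the end of that segment to a given
element of `S`. -/
lemma exists_perm_mem_iff_lt_and_eq {d : ℕ} {S : Finset (Fin d)} {k j₀ : Fin d} (hk : k ∈ S)
    (hj₀ : (j₀ : ℕ) + 1 = S.card) :
    ∃ σ : Equiv.Perm (Fin d), (∀ j, σ j ∈ S ↔ (j : ℕ) < S.card) ∧ σ j₀ = k := by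
  obtain ⟨σ, hσ⟩ := exists_perm_mem_iff_lt S
  refine ⟨(Equiv.swap j₀ (σ.symm k)).trans σ, fun j => ?_, by simp⟩
  have hk' : ((σ.symm k : Fin d) : ℕ) < S.card := by rw [← hσ]; simpa using hk
  have hj' : (j₀ : ℕ) < S.card := by omega
  rw [Equiv.trans_apply, hσ]
  by_cases h1 : j = j₀
  · subst h1; simp [hk', hj']
  by_cases h2 : j = σ.symm k
  · subst h2; simp [hk', hj']
  · rw [Equiv.swap_apply_of_ne_of_ne h1 h2]

lemma comp_perm_mem_region_iff {d : ℕ} {S : Finset (Fin d)} {σ : Equiv.Perm (Fin d)}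
    (hσ : ∀ j, σ j ∈ S ↔ (j : ℕ) < S.card) (γ : Fin d → ℝ≥0) (G : ℝ≥0) :
    γ ∘ σ ∈ region d S.card G ↔ γ ∈ cutRegion S G := by
  simp only [region, cutRegion, Set.mem_ofPred_eq, ← hσ]
  exact σ.forall_congr_right (q := fun j => if j ∈ S then γ j ≤ G else G ≤ γ j)

/-- The binomial coefficient counts the sets of coordinates below the level. -/
lemma choose_mul_lintegral_region {d : ℕ} (ℓ : ℕ) {F : (Fin d → ℝ≥0) → ℝ≥0∞} (hF : Measurable F)
    (hsymm : ∀ (σ : Equiv.Perm (Fin d)) γ, F (γ ∘ σ) = F γ) {p : ℝ≥0 → ℝ≥0∞}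
    (hp : Measurable p) :
    (d.choose ℓ : ℝ≥0∞) * ∫⁻ G, p G * ∫⁻ γ in region d ℓ G, F γ ∂(lebesguePi d) ∂lebesgue =
      ∫⁻ γ, F γ * ∑ S ∈ Finset.powersetCard ℓ Finset.univ,
        ∫⁻ G, {G | γ ∈ cutRegion S G}.indicator p G ∂lebesgue ∂(lebesguePi d) := by
  have hm (S : Finset (Fin d)) : Measurable fun q : (Fin d → ℝ≥0) × ℝ≥0 =>
      {G | q.1 ∈ cutRegion S G}.indicator p q.2 :=
    Measurable.indicator (s := {q : (Fin d → ℝ≥0) × ℝ≥0 | q.1 ∈ cutRegion S q.2})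
      (f := fun q => p q.2) (by fun_prop) (measurable_swap (measurableSet_cutRegion S))
  have h1 : ∫⁻ G, p G * ∫⁻ γ in region d ℓ G, F γ ∂(lebesguePi d) ∂lebesgue =
      ∫⁻ γ, F γ * ∫⁻ G, {G | γ ∈ region d ℓ G}.indicator p G ∂lebesgue ∂(lebesguePi d) := by
    simp_rw [region_eq_cutRegion]
    set S := Finset.univ.filter fun j : Fin d => (j : ℕ) < ℓ
    have h2 (G : ℝ≥0) : p G * ∫⁻ γ in cutRegion S G, F γ ∂(lebesguePi d) =
        ∫⁻ γ, F γ * {G | γ ∈ cutRegion S G}.indicator p G ∂(lebesguePi d) := by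
      have hG : MeasurableSet (cutRegion S G) :=
        measurable_prodMk_left (x := G) (measurableSet_cutRegion S)
      rw [← lintegral_indicator hG, ← lintegral_const_mul _ (hF.indicator hG)]
      refine lintegral_congr fun γ => ?_
      by_cases h : γ ∈ cutRegion S G <;> simp [Set.indicator, h, mul_comm]
    simp_rw [h2]
    rw [lintegral_lintegral_swap]
    · exact lintegral_congr fun γ =>
        lintegral_const_mul _ ((hm S).comp (measurable_prodMk_left (x := γ)))
    · exact ((hF.comp measurable_snd).mul ((hm S).comp measurable_swap)).aemeasurable
  have h3 : ∀ S ∈ Finset.powersetCard ℓ Finset.univ,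
      ∫⁻ γ, F γ * ∫⁻ G, {G | γ ∈ cutRegion S G}.indicator p G ∂lebesgue ∂(lebesguePi d) =
        ∫⁻ γ, F γ * ∫⁻ G, {G | γ ∈ region d ℓ G}.indicator p G ∂lebesgue ∂(lebesguePi d) := by
    intro S hS
    obtain rfl := (Finset.mem_powersetCard.1 hS).2
    obtain ⟨σ, hσ⟩ := exists_perm_mem_iff_lt S
    rw [← lintegral_lebesguePi_comp_perm σ fun γ =>
      F γ * ∫⁻ G, {G | γ ∈ region d S.card G}.indicator p G ∂lebesgue]
    simp_rw [comp_perm_mem_region_iff hσ, hsymm]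
  simp_rw [Finset.mul_sum]
  have hmS (S : Finset (Fin d)) : Measurable fun γ : Fin d → ℝ≥0 =>
      F γ * ∫⁻ G, {G | γ ∈ cutRegion S G}.indicator p G ∂lebesgue :=
    hF.mul (hm S).lintegral_prod_right'
  rw [lintegral_finsetSum _ fun S _ => hmS S,
    Finset.sum_congr rfl h3, h1]
  simp

lemma lintegral_boundaryMeasure {d : ℕ} (j₀ : Fin (d + 1)) (G : ℝ≥0)
    {Φ : (Fin (d + 1) → ℝ≥0) → ℝ≥0∞} (hΦ : Measurable Φ) :
    ∫⁻ γ, Φ γ ∂(boundaryMeasure (d + 1) (j₀ + 1) G) =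
      ∫⁻ γ, Φ (j₀.insertNth G γ) ∂(lebesguePi d) := by
  have hσ (j : Fin (d + 1)) : SigmaFinite
      (if (j : ℕ) + 1 = (j₀ : ℕ) + 1 then Measure.dirac G else lebesgue) := by
    split_ifs <;> infer_instance
  have h := (measurePreserving_piFinSuccAbove (fun j : Fin (d + 1) =>
    if (j : ℕ) + 1 = (j₀ : ℕ) + 1 then Measure.dirac G else lebesgue) j₀).symm
  rw [boundaryMeasure, ← h.lintegral_comp_emb (MeasurableEquiv.measurableEmbedding _),
    lintegral_prod _ (by fun_prop)]
  have hpi : (Measure.pi fun j : Fin d => if ((j₀.succAbove j : Fin (d + 1)) : ℕ) + 1 =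
      (j₀ : ℕ) + 1 then Measure.dirac G else lebesgue) = lebesguePi d := by
    rw [lebesguePi]
    congr 1
    funext j
    rw [if_neg]
    have := Fin.succAbove_ne j₀ j
    rwa [Nat.add_right_cancel_iff, Fin.val_inj]
  have hins : Measurable fun q : ℝ≥0 × (Fin d → ℝ≥0) =>
      Φ ((MeasurableEquiv.piFinSuccAbove (fun _ => ℝ≥0) j₀).symm q) := by fun_prop
  simp only [if_true, hpi]
  exact lintegral_dirac' _ hins.lintegral_prod_right'

/-- The factor `ℓ * d.choose ℓ` counts the sets of coordinates below the level together with the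
choice of the coordinate that is at the level. -/
lemma mul_choose_mul_lintegral_boundary {d : ℕ} {ℓ : ℕ} (h1 : 1 ≤ ℓ) (h2 : ℓ ≤ d + 1)
    {F : (Fin (d + 1) → ℝ≥0) → ℝ≥0∞} (hF : Measurable F)
    (hsymm : ∀ (σ : Equiv.Perm (Fin (d + 1))) γ, F (γ ∘ σ) = F γ) {p : ℝ≥0 → ℝ≥0∞}
    (hp : Measurable p) :
    (ℓ : ℝ≥0∞) * ((d + 1).choose ℓ : ℝ≥0∞) * ∫⁻ G, p G *
        ∫⁻ γ in region (d + 1) ℓ G, F γ ∂(boundaryMeasure (d + 1) ℓ G) ∂lebesgue =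
      ∫⁻ γ, F γ * ∑ S ∈ Finset.powersetCard ℓ Finset.univ, ∑ k ∈ S,
        {γ | γ ∈ cutRegion S (γ k)}.indicator (fun γ => p (γ k)) γ ∂(lebesguePi (d + 1)) := by
  have hset (S : Finset (Fin (d + 1))) (k : Fin (d + 1)) :
      MeasurableSet {γ : Fin (d + 1) → ℝ≥0 | γ ∈ cutRegion S (γ k)} :=
    (show Measurable fun γ : Fin (d + 1) → ℝ≥0 => (γ k, γ) by fun_prop) (measurableSet_cutRegion S)
  have hm (S : Finset (Fin (d + 1))) (k : Fin (d + 1)) : Measurable fun γ : Fin (d + 1) → ℝ≥0 =>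
      {γ | γ ∈ cutRegion S (γ k)}.indicator (fun γ => p (γ k)) γ :=
    Measurable.indicator (by fun_prop) (hset S k)
  have hFm (S : Finset (Fin (d + 1))) (k : Fin (d + 1)) : Measurable fun γ : Fin (d + 1) → ℝ≥0 =>
      F γ * {γ | γ ∈ cutRegion S (γ k)}.indicator (fun γ => p (γ k)) γ := hF.mul (hm S k)
  obtain ⟨j₀, rfl⟩ : ∃ j₀ : Fin (d + 1), (j₀ : ℕ) + 1 = ℓ :=
    ⟨⟨ℓ - 1, by omega⟩, Nat.sub_add_cancel h1⟩
  have h3 : ∫⁻ G, p G * ∫⁻ γ in region (d + 1) (j₀ + 1) G, F γ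
        ∂(boundaryMeasure (d + 1) (j₀ + 1) G) ∂lebesgue =
      ∫⁻ γ, F γ * {γ | γ ∈ region (d + 1) (j₀ + 1) (γ j₀)}.indicator (fun γ => p (γ j₀)) γ
        ∂(lebesguePi (d + 1)) := by
    simp_rw [region_eq_cutRegion]
    set S := Finset.univ.filter fun j : Fin (d + 1) => (j : ℕ) < j₀ + 1
    rw [lintegral_lebesguePi_insertNth j₀ (hFm S j₀)]
    refine lintegral_congr fun G => ?_
    have hG : MeasurableSet (cutRegion S G) :=
      measurable_prodMk_left (x := G) (measurableSet_cutRegion S)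
    have hins : Measurable fun γ : Fin d → ℝ≥0 => (j₀.insertNth G γ : Fin (d + 1) → ℝ≥0) :=
      (MeasurableEquiv.piFinSuccAbove (fun _ => ℝ≥0) j₀).symm.measurable.comp
        (measurable_prodMk_left (x := G))
    have hFi : Measurable fun γ : Fin d → ℝ≥0 => (cutRegion S G).indicator F (j₀.insertNth G γ) :=
      (hF.indicator hG).comp hins
    rw [← lintegral_indicator hG, lintegral_boundaryMeasure _ _ (hF.indicator hG),
      ← lintegral_const_mul _ hFi]
    refine lintegral_congr fun γ => ?_
    by_cases h : (j₀.insertNth G γ : Fin (d + 1) → ℝ≥0) ∈ cutRegion S G <;>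
      simp [Set.indicator, h, mul_comm]
  have h4 : ∀ S ∈ Finset.powersetCard ((j₀ : ℕ) + 1) Finset.univ, ∀ k ∈ S,
      ∫⁻ γ, F γ * {γ | γ ∈ cutRegion S (γ k)}.indicator (fun γ => p (γ k)) γ
        ∂(lebesguePi (d + 1)) =
      ∫⁻ γ, F γ * {γ | γ ∈ region (d + 1) (j₀ + 1) (γ j₀)}.indicator (fun γ => p (γ j₀)) γ
        ∂(lebesguePi (d + 1)) := by
    intro S hS k hk
    have hcard := (Finset.mem_powersetCard.1 hS).2
    obtain ⟨σ, hσ, hσk⟩ := exists_perm_mem_iff_lt_and_eq hk hcard.symm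
    rw [← lintegral_lebesguePi_comp_perm σ fun γ => F γ *
      {γ | γ ∈ region (d + 1) (j₀ + 1) (γ j₀)}.indicator (fun γ => p (γ j₀)) γ, ← hcard]
    refine lintegral_congr fun γ => ?_
    have hiff : γ ∘ σ ∈ {γ : Fin (d + 1) → ℝ≥0 | γ ∈ region (d + 1) S.card (γ j₀)} ↔
        γ ∈ {γ : Fin (d + 1) → ℝ≥0 | γ ∈ cutRegion S (γ k)} := by
      rw [Set.mem_ofPred_eq, Set.mem_ofPred_eq, Function.comp_apply, hσk]
      exact comp_perm_mem_region_iff hσ γ (γ k)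
    by_cases h : γ ∈ {γ : Fin (d + 1) → ℝ≥0 | γ ∈ cutRegion S (γ k)}
    · rw [Set.indicator_of_mem h, Set.indicator_of_mem (hiff.2 h), hsymm, Function.comp_apply, hσk]
    · rw [Set.indicator_of_notMem h, Set.indicator_of_notMem (mt hiff.1 h), hsymm]
  simp_rw [Finset.mul_sum]
  rw [lintegral_finsetSum _ fun S _ => Finset.measurable_fun_sum _ fun k _ => hFm S k,
    Finset.sum_congr rfl fun S hS => (lintegral_finsetSum _ fun k _ => hFm S k).trans
      (Finset.sum_congr rfl (h4 S hS)), h3]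
  have h5 : ∀ S ∈ Finset.powersetCard ((j₀ : ℕ) + 1) (Finset.univ : Finset (Fin (d + 1))),
      S.card = (j₀ : ℕ) + 1 := fun S hS => (Finset.mem_powersetCard.1 hS).2
  simp only [Finset.sum_const]
  rw [Finset.sum_congr rfl fun S hS => by rw [h5 S hS]]
  simp only [Finset.sum_const, Finset.card_powersetCard, Finset.card_univ, Fintype.card_fin,
    nsmul_eq_mul]
  ring

/-! ### The weights of all cuts add up to a Poisson tail -/

/-- A telescoping sum for Poisson tails along finitely many levels `A`: as the mean grows from `0`
to `m`, the tail index drops by one at each element of `A`. Between two levels the tail grows by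
the integral of a weight, and at a level it jumps by a weight. -/
lemma lintegral_poissonWeight_add_sum {K : ℕ} (A : Finset ℝ≥0) (hA : A.card < K) {m : ℝ≥0}
    (hm : ∀ a ∈ A, a ≤ m) :
    ∫⁻ G in Set.Iic m, poissonWeight (K - 1 - (A.filter (· < G)).card) G ∂lebesgue +
      ∑ a ∈ A, poissonWeight (K - (A.filter (· ≤ a)).card) a = poissonTail (K - A.card) m := by
  induction A using Finset.induction_on_max generalizing m with
  | empty =>
    have h := lintegral_poissonWeight_add_tail (K - 1) (zero_le : 0 ≤ m)
    rw [Nat.sub_add_cancel (by simp at hA; omega), poissonTail_zero_right (by simp at hA; omega),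
      add_zero] at h
    simp only [Finset.filter_empty, Finset.card_empty, Nat.sub_zero, Finset.sum_empty, add_zero]
    rw [← h]
    congr 2; ext; simp
  | insert b B hB ih =>
    have hbB : b ∉ B := fun h => lt_irrefl _ (hB b h)
    have hbm : b ≤ m := hm b (Finset.mem_insert_self _ _)
    rw [Finset.card_insert_of_notMem hbB] at hA ⊢
    -- the new largest level `b` matters for `G > b` only
    have h1 : ∫⁻ G in Set.Iic b, poissonWeight (K - 1 - ((insert b B).filter (· < G)).card) G
          ∂lebesgue =
        ∫⁻ G in Set.Iic b, poissonWeight (K - 1 - (B.filter (· < G)).card) G ∂lebesgue := by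
      refine setLIntegral_congr_fun measurableSet_Iic fun G hG => ?_
      simp only [Finset.filter_insert, not_lt.2 (Set.mem_Iic.1 hG), if_false]
    have h2 : ∫⁻ G in Set.Ioc b m, poissonWeight (K - 1 - ((insert b B).filter (· < G)).card) G
          ∂lebesgue = ∫⁻ G in Set.Icc b m, poissonWeight (K - (B.card + 1) - 1) G ∂lebesgue := by
      rw [← setLIntegral_congr (Ioc_ae_eq_Icc (μ := lebesgue))]
      refine setLIntegral_congr_fun measurableSet_Ioc fun G hG => ?_
      have : (insert b B).filter (· < G) = insert b B := by
        refine Finset.filter_true_of_mem fun a ha => ?_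
        rcases Finset.mem_insert.1 ha with rfl | ha
        · exact hG.1
        · exact (hB a ha).trans hG.1
      simp only [this, Finset.card_insert_of_notMem hbB]
      congr 1; omega
    have h3 : ∑ a ∈ insert b B, poissonWeight (K - ((insert b B).filter (· ≤ a)).card) a =
        poissonWeight (K - (B.card + 1)) b +
          ∑ a ∈ B, poissonWeight (K - (B.filter (· ≤ a)).card) a := by
      rw [Finset.sum_insert hbB]
      congr 1
      · rw [Finset.filter_true_of_mem, Finset.card_insert_of_notMem hbB]
        intro a ha
        rcases Finset.mem_insert.1 ha with rfl | ha
        · exact le_rfl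
        · exact (hB a ha).le
      · refine Finset.sum_congr rfl fun a ha => ?_
        rw [Finset.filter_insert, if_neg (not_le.2 (hB a ha))]
    have h4 := lintegral_poissonWeight_add_tail (K - (B.card + 1) - 1) hbm
    rw [Nat.sub_add_cancel (by omega)] at h4
    have h5 := ih (by omega) fun a ha => (hB a ha).le
    have h6 := poissonTail_succ (K - (B.card + 1)) b
    rw [show K - (B.card + 1) + 1 = K - B.card by omega, ← h5] at h6
    rw [← h4, ← h6, ← Set.Iic_union_Ioc_eq_Iic hbm, lintegral_union measurableSet_Ioc
      (Set.Iic_disjoint_Ioc le_rfl), h1, h2, h3]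
    ring

lemma sum_powersetCard_eq {d : ℕ} (I : Finset ℕ) (f : ℕ → ℝ≥0∞) (S₀ : Finset (Fin d)) :
    ∑ ℓ ∈ I, ∑ S ∈ Finset.powersetCard ℓ Finset.univ, (if S = S₀ then f ℓ else 0) =
      if S₀.card ∈ I then f S₀.card else 0 := by
  simp [Finset.sum_ite_eq', Finset.mem_powersetCard, eq_comm (a := S₀.card)]

lemma mem_cutRegion_iff_of_ne {d : ℕ} {γ : Fin d → ℝ≥0} {G : ℝ≥0} (hG : ∀ j, γ j ≠ G)
    (S : Finset (Fin d)) :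
    γ ∈ cutRegion S G ↔ S = Finset.univ.filter fun j => γ j < G := by
  simp only [cutRegion, Set.mem_ofPred_eq, Finset.ext_iff, Finset.mem_filter, Finset.mem_univ,
    true_and]
  refine forall_congr' fun j => ?_
  by_cases hj : j ∈ S
  · simpa [hj] using ⟨fun h => lt_of_le_of_ne h (hG j), le_of_lt⟩
  · simp [hj]

lemma mem_cutRegion_apply_iff {d : ℕ} {γ : Fin d → ℝ≥0} (hγ : Function.Injective γ)
    (S : Finset (Fin d)) (k : Fin d) :
    (k ∈ S ∧ γ ∈ cutRegion S (γ k)) ↔ S = Finset.univ.filter fun j => γ j ≤ γ k := by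
  constructor
  · rintro ⟨hk, h⟩
    ext j
    have hj := h j
    by_cases hjS : j ∈ S
    · simpa [hjS] using hj
    · have hne : γ j ≠ γ k := fun he => hjS (hγ he ▸ hk)
      simp only [hjS, if_false] at hj
      simpa [hjS] using lt_of_le_of_ne hj hne.symm
  · rintro rfl
    refine ⟨by simp, fun j => ?_⟩
    by_cases hj : γ j ≤ γ k
    · simp [hj]
    · simp [hj, (not_le.1 hj).le]

/-- For a tuple with distinct entries, the weights of all cuts add up to the tail at the largest
entry. -/
lemma sum_cutRegion_eq_poissonTail {d K : ℕ} (hK : d < K) {γ : Fin (d + 1) → ℝ≥0}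
    (hγ : Function.Injective γ) :
    ∑ ℓ ∈ Finset.range (d + 1), ∑ S ∈ Finset.powersetCard ℓ Finset.univ,
        ∫⁻ G, {G | γ ∈ cutRegion S G}.indicator (poissonWeight (K - 1 - ℓ)) G ∂lebesgue +
      ∑ ℓ ∈ Finset.Icc 1 d, ∑ S ∈ Finset.powersetCard ℓ Finset.univ, ∑ k ∈ S,
        {γ | γ ∈ cutRegion S (γ k)}.indicator (fun γ => poissonWeight (K - ℓ) (γ k)) γ =
      poissonTail (K - d) (Finset.univ.sup γ) := by
  classical
  obtain ⟨j₁, -, hj₁⟩ := Finset.exists_mem_eq_sup Finset.univ Finset.univ_nonempty γ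
  set m := Finset.univ.sup γ with hm
  have hle (j : Fin (d + 1)) : γ j ≤ m := Finset.le_sup (Finset.mem_univ j)
  -- the entries of `γ` below the largest one
  set A : Finset ℝ≥0 := (Finset.univ.erase j₁).image γ with hA
  have hcard : A.card = d := by
    rw [hA, Finset.card_image_of_injective _ hγ, Finset.card_erase_of_mem (Finset.mem_univ _)]
    simp
  have hlt {j : Fin (d + 1)} (hj : j ≠ j₁) : γ j < m :=
    lt_of_le_of_ne (hle j) fun h => hj (hγ (h.trans hj₁))
  have hX := lintegral_poissonWeight_add_sum (K := K) A (hcard ▸ hK) (m := m) (by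
    intro a ha
    obtain ⟨j, -, rfl⟩ := Finset.mem_image.1 ha
    exact hle j)
  rw [hcard] at hX
  rw [← hX]
  congr 1
  · have hmG (ℓ : ℕ) (S : Finset (Fin (d + 1))) : Measurable fun G =>
        {G | γ ∈ cutRegion S G}.indicator (poissonWeight (K - 1 - ℓ)) G :=
      (measurable_poissonWeight _).indicator
        ((measurable_prodMk_right (y := γ)) (measurableSet_cutRegion S))
    rw [← lintegral_indicator measurableSet_Iic,
      Finset.sum_congr rfl fun ℓ _ => (lintegral_finsetSum _ fun S _ => hmG ℓ S).symm,
      ← lintegral_finsetSum _ fun ℓ _ => Finset.measurable_fun_sum _ fun S _ => hmG ℓ S]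
    -- off the entries of `γ`, exactly one set of coordinates lies below the level
    have hne : ∀ᵐ G ∂lebesgue, ∀ j, γ j ≠ G := by
      refine ae_all_iff.2 fun j => ?_
      simp [ae_iff]
    refine lintegral_congr_ae ?_
    filter_upwards [hne] with G hG
    simp only [Set.indicator, Set.mem_ofPred_eq, mem_cutRegion_iff_of_ne hG]
    rw [sum_powersetCard_eq (Finset.range (d + 1)) (fun ℓ => poissonWeight (K - 1 - ℓ) G)]
    by_cases hGm : G ≤ m
    · have hS : A.filter (· < G) = (Finset.univ.filter fun j => γ j < G).image γ := by
        ext a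
        simp only [hA, Finset.mem_filter, Finset.mem_image, Finset.mem_erase, Finset.mem_univ,
          and_true, true_and]
        constructor
        · rintro ⟨⟨j, -, rfl⟩, h⟩; exact ⟨j, h, rfl⟩
        · rintro ⟨j, h, rfl⟩
          exact ⟨⟨j, fun hj => (h.trans_le hGm).ne (hj ▸ hj₁.symm), rfl⟩, h⟩
      have hS2 : (A.filter (· < G)).card = (Finset.univ.filter fun j => γ j < G).card := by
        rw [hS, Finset.card_image_of_injective _ hγ]
      have hS3 : (A.filter (· < G)).card < d + 1 :=
        Nat.lt_succ_of_le ((Finset.card_filter_le _ _).trans hcard.le)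
      rw [← hS2, if_pos (Finset.mem_range.2 hS3), if_pos (Set.mem_Iic.2 hGm)]
    · have hS : (Finset.univ.filter fun j => γ j < G) = Finset.univ :=
        Finset.filter_true_of_mem fun j _ => (hle j).trans_lt (not_le.1 hGm)
      rw [hS, if_neg (by simp), if_neg (by simpa using hGm)]
  · have h1 : ∀ ℓ ∈ Finset.Icc 1 d, ∑ S ∈ Finset.powersetCard ℓ Finset.univ, ∑ k ∈ S,
          {γ | γ ∈ cutRegion S (γ k)}.indicator (fun γ => poissonWeight (K - ℓ) (γ k)) γ =
        ∑ k, ∑ S ∈ Finset.powersetCard ℓ Finset.univ,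
          if S = Finset.univ.filter (fun j => γ j ≤ γ k) then poissonWeight (K - ℓ) (γ k)
          else 0 := by
      intro ℓ _
      rw [Finset.sum_comm]
      refine Finset.sum_congr rfl fun S _ => ?_
      have h2 (f : Fin (d + 1) → ℝ≥0∞) : ∑ k ∈ S, f k = ∑ k, if k ∈ S then f k else 0 := by
        simp [Finset.sum_ite_mem]
      rw [h2]
      refine Finset.sum_congr rfl fun k _ => ?_
      simp only [← mem_cutRegion_apply_iff hγ, Set.indicator, Set.mem_ofPred_eq, ite_and]
    rw [Finset.sum_congr rfl h1, Finset.sum_comm]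
    rw [Finset.sum_congr rfl fun k _ => sum_powersetCard_eq (Finset.Icc 1 d)
      (fun ℓ => poissonWeight (K - ℓ) (γ k)) (Finset.univ.filter fun j => γ j ≤ γ k)]
    rw [hA, Finset.sum_image (fun _ _ _ _ h => hγ h), ← hA,
      ← Finset.add_sum_erase _ _ (Finset.mem_univ j₁)]
    -- a cut at the largest entry has all `d + 1` coordinates below it and is not counted
    have h2 : (Finset.univ.filter fun j => γ j ≤ γ j₁) = Finset.univ :=
      Finset.filter_true_of_mem fun j _ => hj₁ ▸ hle j
    rw [h2, if_neg (by simp), zero_add]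
    refine Finset.sum_congr rfl fun k hk => ?_
    have hk' : γ k < m := hlt (Finset.ne_of_mem_erase hk)
    have hS : A.filter (· ≤ γ k) = (Finset.univ.filter fun j => γ j ≤ γ k).image γ := by
      ext a
      simp only [hA, Finset.mem_filter, Finset.mem_image, Finset.mem_erase, Finset.mem_univ,
        and_true, true_and]
      constructor
      · rintro ⟨⟨j, -, rfl⟩, h⟩; exact ⟨j, h, rfl⟩
      · rintro ⟨j, h, rfl⟩
        exact ⟨⟨j, fun hj => (h.trans_lt hk').ne (hj ▸ hj₁.symm), rfl⟩, h⟩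
    have hS2 : (A.filter (· ≤ γ k)).card = (Finset.univ.filter fun j => γ j ≤ γ k).card := by
      rw [hS, Finset.card_image_of_injective _ hγ]
    have hS3 : 1 ≤ (Finset.univ.filter fun j => γ j ≤ γ k).card :=
      Finset.card_pos.2 ⟨k, by simp⟩
    rw [if_pos (Finset.mem_Icc.2 ⟨hS3, hS2 ▸ (Finset.card_filter_le _ _).trans hcard.le⟩), hS2]

/-! ### Integration over levels and marks -/

section

/-- The contributions of all cuts to a symmetric function, integrated over the level. -/
theorem sum_lintegral_region_add_sum_lintegral_boundary {d K : ℕ} (hK : d < K)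
    {F : (Fin (d + 1) → ℝ≥0) → ℝ≥0∞} (hF : Measurable F)
    (hsymm : ∀ (σ : Equiv.Perm (Fin (d + 1))) γ, F (γ ∘ σ) = F γ) :
    ∑ ℓ ∈ Finset.range (d + 1), ((d + 1).choose ℓ : ℝ≥0∞) *
        ∫⁻ G, poissonWeight (K - 1 - ℓ) G *
          ∫⁻ γ in region (d + 1) ℓ G, F γ ∂(lebesguePi (d + 1)) ∂lebesgue +
      ∑ ℓ ∈ Finset.Icc 1 d, (ℓ : ℝ≥0∞) * ((d + 1).choose ℓ : ℝ≥0∞) *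
        ∫⁻ G, poissonWeight (K - ℓ) G *
          ∫⁻ γ in region (d + 1) ℓ G, F γ ∂(boundaryMeasure (d + 1) ℓ G) ∂lebesgue =
      ∫⁻ γ, poissonTail (K - d) (Finset.univ.sup γ) * F γ ∂(lebesguePi (d + 1)) := by
  have h1 (ℓ : ℕ) : Measurable fun γ : Fin (d + 1) → ℝ≥0 =>
      F γ * ∑ S ∈ Finset.powersetCard ℓ Finset.univ,
        ∫⁻ G, {G | γ ∈ cutRegion S G}.indicator (poissonWeight (K - 1 - ℓ)) G ∂lebesgue := by
    refine hF.mul (Finset.measurable_fun_sum _ fun S _ => ?_)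
    have : Measurable fun q : (Fin (d + 1) → ℝ≥0) × ℝ≥0 =>
        {G | q.1 ∈ cutRegion S G}.indicator (poissonWeight (K - 1 - ℓ)) q.2 :=
      Measurable.indicator (s := {q : (Fin (d + 1) → ℝ≥0) × ℝ≥0 | q.1 ∈ cutRegion S q.2})
        (f := fun q => poissonWeight (K - 1 - ℓ) q.2) (by fun_prop)
        (measurable_swap (measurableSet_cutRegion S))
    exact this.lintegral_prod_right'
  have h2 (ℓ : ℕ) : Measurable fun γ : Fin (d + 1) → ℝ≥0 =>
      F γ * ∑ S ∈ Finset.powersetCard ℓ Finset.univ, ∑ k ∈ S,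
        {γ | γ ∈ cutRegion S (γ k)}.indicator (fun γ => poissonWeight (K - ℓ) (γ k)) γ := by
    refine hF.mul (Finset.measurable_fun_sum _ fun S _ => Finset.measurable_fun_sum _ fun k _ => ?_)
    exact Measurable.indicator (by fun_prop)
      ((show Measurable fun γ : Fin (d + 1) → ℝ≥0 => (γ k, γ) by fun_prop)
        (measurableSet_cutRegion S))
  rw [Finset.sum_congr rfl fun ℓ _ => choose_mul_lintegral_region ℓ hF hsymm
      (measurable_poissonWeight (K - 1 - ℓ)),
    Finset.sum_congr rfl fun ℓ hℓ => mul_choose_mul_lintegral_boundary (Finset.mem_Icc.1 hℓ).1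
      ((Finset.mem_Icc.1 hℓ).2.trans d.le_succ) hF hsymm (measurable_poissonWeight (K - ℓ)),
    ← lintegral_finsetSum _ fun ℓ _ => h1 ℓ, ← lintegral_finsetSum _ fun ℓ _ => h2 ℓ,
    ← lintegral_add_left (Finset.measurable_fun_sum _ fun ℓ _ => h1 ℓ)]
  refine lintegral_congr_ae ?_
  filter_upwards [ae_injective_lebesguePi d] with γ hγ
  rw [← Finset.mul_sum, ← Finset.mul_sum, ← mul_add, sum_cutRegion_eq_poissonTail hK hγ, mul_comm]

/-- The factors of the truncation bound turn the density of `Γ_{n+1}` into that of `Γ_{n+1-ℓ}`. -/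
lemma poissonWeight_mul_descFactorial {n ℓ : ℕ} (h : ℓ ≤ n) {G : ℝ≥0} (hG : G ≠ 0) :
    poissonWeight n G * ((n.descFactorial ℓ : ℝ≥0∞) * ((G : ℝ≥0∞) ^ ℓ)⁻¹) =
      poissonWeight (n - ℓ) G := by
  have hG' : 0 < (G : ℝ) := by positivity
  have h1 : (n.descFactorial ℓ : ℝ≥0∞) * ((G : ℝ≥0∞) ^ ℓ)⁻¹ =
      ENNReal.ofReal (n.descFactorial ℓ * ((G : ℝ) ^ ℓ)⁻¹) := by
    rw [ENNReal.ofReal_mul (by positivity), ENNReal.ofReal_natCast,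
      ENNReal.ofReal_inv_of_pos (by positivity), ENNReal.ofReal_pow G.coe_nonneg,
      ENNReal.ofReal_coe_nnreal]
  rw [h1, poissonWeight, poissonWeight, ← ENNReal.ofReal_mul (by positivity)]
  congr 1
  have h2 : (n.factorial : ℝ) = (n - ℓ).factorial * n.descFactorial ℓ := by
    exact_mod_cast (Nat.factorial_mul_descFactorial h).symm
  have h3 : (G : ℝ) ^ n = (G : ℝ) ^ (n - ℓ) * (G : ℝ) ^ ℓ := by
    rw [← pow_add, Nat.sub_add_cancel h]
  have h4 : (n.descFactorial ℓ : ℝ) ≠ 0 := by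
    have := Nat.descFactorial_pos.2 h
    positivity
  have h5 : ((n - ℓ).factorial : ℝ) ≠ 0 := by positivity
  rw [h2, h3]
  field_simp

@[fun_prop]
lemma measurable_negLogPi (h : Kernel ℝ≥0 ℕ) : Measurable (negLogPi h) := by
  unfold negLogPi
  have h1 : Measurable fun ϑ => h ϑ {0} := h.measurable_coe (.singleton 0)
  exact measurable_ereal_toENNReal.comp (continuous_neg.measurable.comp h1.ennreal_log)

/-- The mean over i.i.d. marks of `-log π` at the product of the rates of points at the
positions `γ`. -/
noncomputable def markIntegral (h : Kernel ℝ≥0 ℕ) (τ : ℝ≥0 → ℝ≥0 → ℝ≥0) (g : Measure ℝ≥0) {d : ℕ}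
    (γ : Fin d → ℝ≥0) : ℝ≥0∞ :=
  ∫⁻ u, negLogPi h (∏ j, τ (u j) (γ j)) ∂(Measure.pi fun _ => g)

section

variable {h : Kernel ℝ≥0 ℕ} {τ : ℝ≥0 → ℝ≥0 → ℝ≥0} {g : Measure ℝ≥0}

lemma measurable_negLogPi_prod (hτ : Measurable (Function.uncurry τ)) {d : ℕ} :
    Measurable fun q : (Fin d → ℝ≥0) × (Fin d → ℝ≥0) =>
      negLogPi h (∏ j, τ (q.1 j) (q.2 j)) := by
  have h1 (j : Fin d) : Measurable fun q : (Fin d → ℝ≥0) × (Fin d → ℝ≥0) => τ (q.1 j) (q.2 j) :=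
    hτ.comp (show Measurable fun q : (Fin d → ℝ≥0) × (Fin d → ℝ≥0) => (q.1 j, q.2 j) by fun_prop)
  exact (measurable_negLogPi h).comp (Finset.measurable_fun_prod _ fun j _ => h1 j)

lemma measurable_markIntegral [IsProbabilityMeasure g] (hτ : Measurable (Function.uncurry τ))
    {d : ℕ} :
    Measurable (markIntegral h τ g : (Fin d → ℝ≥0) → ℝ≥0∞) :=
  (measurable_negLogPi_prod hτ).lintegral_prod_left'

lemma markIntegral_comp_perm [IsProbabilityMeasure g] {d : ℕ} (σ : Equiv.Perm (Fin d))
    (γ : Fin d → ℝ≥0) :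
    markIntegral h τ g (γ ∘ σ) = markIntegral h τ g γ := by
  rw [markIntegral, markIntegral, ← lintegral_pi_comp_perm g σ]
  refine lintegral_congr fun u => ?_
  congr 1
  exact Equiv.prod_comp σ fun j => τ (u j) (γ j)

variable {Ω : Type*} [MeasurableSpace Ω] {P : Measure Ω} [IsProbabilityMeasure P]
  {E U : ℕ → Ω → ℝ≥0}

lemma IsPoissonWithMarks.map_marks (hEU : IsPoissonWithMarks P g E U) {d : ℕ} (i : Fin d ↪ ℕ) :
    P.map (fun ω j => U (i j) ω) = Measure.pi fun _ => g := by
  have h1 : iIndepFun (fun j => U (i j)) P :=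
    hEU.indep.precomp (g := fun j => Sum.inr (i j)) (Sum.inr_injective.comp i.injective)
  rw [(iIndepFun_iff_map_fun_eq_pi_map fun j => (hEU.measurable_mark _).aemeasurable).1 h1]
  simp_rw [hEU.mark_law]

/-- Averaging over marks that are independent of the arrivals. -/
lemma IsPoissonWithMarks.lintegral_marks (hEU : IsPoissonWithMarks P g E U)
    {d : ℕ} (i : Fin d ↪ ℕ)
    {β : Type*} [MeasurableSpace β] {Y : Ω → β}
    (hY : Measurable[⨆ k ∈ Set.range Sum.inl,
      MeasurableSpace.comap (Sum.elim E U k) inferInstance] Y)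
    {φ : β × (Fin d → ℝ≥0) → ℝ≥0∞} (hφ : Measurable φ) :
    ∫⁻ ω, φ (Y ω, fun j => U (i j) ω) ∂P =
      ∫⁻ ω, ∫⁻ u, φ (Y ω, u) ∂(Measure.pi fun _ => g) ∂P := by
  have hind : IndepFun Y (fun ω j => U (i j) ω) P := by
    refine indepFun_of_measurable_iSup hEU.indep hEU.measurable_elim (S := Set.range Sum.inl)
      (T := Set.range Sum.inr) Set.isCompl_range_inl_range_inr.disjoint hY ?_
    refine @measurable_pi_lambda _ _ _ (_) _ _ fun j => ?_
    exact measurable_iSup_comap (Sum.elim E U) (i := Sum.inr (i j)) ⟨_, rfl⟩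
  have hY' : Measurable Y := hY.mono
    (iSup₂_le fun k _ => (hEU.measurable_elim k).comap_le) le_rfl
  have hU := hEU.measurable_mark
  rw [lintegral_of_indepFun hind hY' (by fun_prop) hφ, hEU.map_marks]

lemma lintegral_negLogPi_rate (hEU : IsPoissonWithMarks P g E U)
    (hτ : Measurable (Function.uncurry τ)) {d : ℕ} (i : Fin d ↪ ℕ) :
    ∫⁻ ω, negLogPi h (edgeWeight (fun k => rate τ E U k ω) i) ∂P =
      ∫⁻ ω, markIntegral h τ g (fun j => arrival E (i j + 1) ω) ∂P := by
  have hY : Measurable[⨆ k ∈ Set.range Sum.inl,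
      MeasurableSpace.comap (Sum.elim E U k) inferInstance]
      (fun ω (j : Fin d) => arrival E (i j + 1) ω) := by
    refine @measurable_pi_lambda _ _ _ (_) _ _ fun j => ?_
    exact measurable_arrival_iSup E U fun j _ => ⟨j, rfl⟩
  have hφ := (measurable_negLogPi_prod (h := h) hτ (d := d)).comp measurable_swap
  have h1 := hEU.lintegral_marks i hY hφ
  simp only [Function.comp_apply, Prod.fst_swap, Prod.snd_swap] at h1
  simp only [edgeWeight, rate, markIntegral]
  exact h1

/-- The expectation of a cut at the level `Γ_K` as an integral over the level. The parametrization
`e` of the tuples of positions covers both Lebesgue measure and its restriction to tuples with one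
coordinate at the level. -/
lemma lintegral_arrival_integrand [IsProbabilityMeasure g] (hEU : IsPoissonWithMarks P g E U)
    (hτ : Measurable (Function.uncurry τ)) {d ℓ n K : ℕ} (hn : n < K)
    {β : Type*} [MeasurableSpace β] (μ : Measure β) [SFinite μ]
    {e : ℝ≥0 × β → Fin d → ℝ≥0} (he : Measurable e) :
    ∫⁻ ω, ((K - 1).descFactorial n : ℝ≥0∞) * ((arrival E K ω : ℝ≥0∞) ^ n)⁻¹ *
        ∫⁻ b, (region d ℓ (arrival E K ω)).indicator (integrand h τ U d ω)
          (e (arrival E K ω, b)) ∂μ ∂P =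
      ∫⁻ G, poissonWeight (K - 1 - n) G *
        ∫⁻ b, (region d ℓ G).indicator (markIntegral h τ g) (e (G, b)) ∂μ ∂lebesgue := by
  have hK : K - 1 + 1 = K := Nat.sub_add_cancel (by omega)
  have hmi {α : Type} [MeasurableSpace α] {f : α × (Fin d → ℝ≥0) → ℝ≥0∞} (hf : Measurable f) :
      Measurable fun q : (ℝ≥0 × α) × β => (region d ℓ q.1.1).indicator
        (fun γ => f (q.1.2, γ)) (e (q.1.1, q.2)) := by
    simp_rw [region_eq_cutRegion]
    set S := Finset.univ.filter fun j : Fin d => (j : ℕ) < ℓ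
    have hpair : Measurable fun q : (ℝ≥0 × α) × β => (q.1.1, e (q.1.1, q.2)) := by fun_prop
    exact Measurable.indicator
      (s := {q : (ℝ≥0 × α) × β | e (q.1.1, q.2) ∈ cutRegion S q.1.1})
      (f := fun q => f (q.1.2, e (q.1.1, q.2))) (by fun_prop)
      (hpair (measurableSet_cutRegion S))
  set f : (Fin d → ℝ≥0) × (Fin d → ℝ≥0) → ℝ≥0∞ :=
    fun q => negLogPi h (∏ j, τ (q.1 j) (q.2 j)) with hf_def
  have hf : Measurable f := measurable_negLogPi_prod hτ
  have hI := hmi hf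
  set c : ℝ≥0 → ℝ≥0∞ := fun G => ((K - 1).descFactorial n : ℝ≥0∞) * ((G : ℝ≥0∞) ^ n)⁻¹
  have hc : Measurable c := by fun_prop
  have hφ : Measurable fun q : ℝ≥0 × (Fin d → ℝ≥0) => c q.1 *
      ∫⁻ b, (region d ℓ q.1).indicator (fun γ => f (q.2, γ)) (e (q.1, b)) ∂μ :=
    (hc.comp measurable_fst).mul hI.lintegral_prod_right'
  have h1 := hEU.lintegral_marks (d := d) Fin.valEmbedding (Y := arrival E K)
    (measurable_arrival_iSup E U fun j _ => ⟨j, rfl⟩) hφ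
  refine h1.trans ?_
  have hψ := hφ.lintegral_prod_right' (ν := Measure.pi fun _ => g)
  rw [← lintegral_map hψ (measurable_arrival hEU.measurable_gap K), ← hK, hEU.map_arrival, hK,
    lintegral_withDensity_eq_lintegral_mul _ (by fun_prop) hψ]
  refine lintegral_congr_ae ?_
  -- at `G = 0` the factor `(G ^ n)⁻¹` is infinite
  have hne : ∀ᵐ G ∂lebesgue, G ≠ 0 := by simp [ae_iff]
  filter_upwards [hne] with G hG
  have hu : Measurable fun q : (Fin d → ℝ≥0) × β =>
      (region d ℓ G).indicator (fun γ => f (q.1, γ)) (e (G, q.2)) :=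
    hI.comp (show Measurable fun q : (Fin d → ℝ≥0) × β => ((G, q.1), q.2) by fun_prop)
  have h3 : ∫⁻ u, c G * ∫⁻ b, (region d ℓ G).indicator (fun γ => f (u, γ)) (e (G, b)) ∂μ
        ∂(Measure.pi fun _ => g) =
      c G * ∫⁻ b, (region d ℓ G).indicator (markIntegral h τ g) (e (G, b)) ∂μ := by
    rw [lintegral_const_mul _ hu.lintegral_prod_right', lintegral_lintegral_swap hu.aemeasurable]
    congr 1
    refine lintegral_congr fun b => ?_
    by_cases hb : e (G, b) ∈ region d ℓ G
    · simp only [Set.indicator_of_mem hb]; rfl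
    · simp only [Set.indicator_of_notMem hb, lintegral_zero]
  rw [← poissonWeight_mul_descFactorial (show n ≤ K - 1 by omega) hG, mul_assoc]
  exact congrArg (poissonWeight (K - 1) G * ·) h3

end

end

/-! ### The truncation bound as one integral, and Jensen's inequality -/

section

variable {Ω : Type*} [MeasurableSpace Ω] {P : Measure Ω} [IsProbabilityMeasure P]
  {h : Kernel ℝ≥0 ℕ} {τ : ℝ≥0 → ℝ≥0 → ℝ≥0} {g : Measure ℝ≥0} [IsProbabilityMeasure g]
  {E U : ℕ → Ω → ℝ≥0}

lemma measurableSet_region (d ℓ : ℕ) (G : ℝ≥0) : MeasurableSet (region d ℓ G) := by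
  rw [region_eq_cutRegion]
  exact measurable_prodMk_left (x := G) (measurableSet_cutRegion _)

lemma lintegral_region_integrand (hEU : IsPoissonWithMarks P g E U)
    (hτ : Measurable (Function.uncurry τ)) {d ℓ n K : ℕ} (hn : n < K) :
    ∫⁻ ω, ((K - 1).descFactorial n : ℝ≥0∞) * ((arrival E K ω : ℝ≥0∞) ^ n)⁻¹ *
        ∫⁻ γ in region d ℓ (arrival E K ω), integrand h τ U d ω γ ∂(lebesguePi d) ∂P =
      ∫⁻ G, poissonWeight (K - 1 - n) G *
        ∫⁻ γ in region d ℓ G, markIntegral h τ g γ ∂(lebesguePi d) ∂lebesgue := by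
  have h1 := lintegral_arrival_integrand (h := h) hEU hτ (ℓ := ℓ) hn (lebesguePi d)
    (e := fun q => q.2) measurable_snd
  simp_rw [lintegral_indicator (measurableSet_region _ _ _)] at h1
  exact h1

lemma lintegral_region_boundary_integrand (hEU : IsPoissonWithMarks P g E U)
    (hτ : Measurable (Function.uncurry τ)) {d n K : ℕ} (hn : n < K) (j₀ : Fin (d + 1)) :
    ∫⁻ ω, ((K - 1).descFactorial n : ℝ≥0∞) * ((arrival E K ω : ℝ≥0∞) ^ n)⁻¹ *
        ∫⁻ γ in region (d + 1) (j₀ + 1) (arrival E K ω), integrand h τ U (d + 1) ω γ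
          ∂(boundaryMeasure (d + 1) (j₀ + 1) (arrival E K ω)) ∂P =
      ∫⁻ G, poissonWeight (K - 1 - n) G *
        ∫⁻ γ in region (d + 1) (j₀ + 1) G, markIntegral h τ g γ
          ∂(boundaryMeasure (d + 1) (j₀ + 1) G) ∂lebesgue := by
  have h1 := lintegral_arrival_integrand (h := h) hEU hτ (ℓ := j₀ + 1) hn (lebesguePi d)
    (e := fun q => j₀.insertNth q.1 q.2)
    (MeasurableEquiv.piFinSuccAbove (fun _ => ℝ≥0) j₀).symm.measurable
  have hm (ω : Ω) : Measurable (integrand h τ U (d + 1) ω) := by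
    have h0 := (measurable_negLogPi_prod (h := h) hτ).comp
      (measurable_prodMk_left (x := fun j : Fin (d + 1) => U j ω))
    unfold integrand
    simpa only [Function.comp_def] using h0
  have hR := measurableSet_region (d + 1) (j₀ + 1)
  have h2 (ω : Ω) := lintegral_boundaryMeasure j₀ (arrival E K ω)
    ((hm ω).indicator (hR (arrival E K ω)))
  have h3 (G : ℝ≥0) := lintegral_boundaryMeasure j₀ G
    ((measurable_markIntegral (h := h) (g := g) hτ).indicator (hR G))
  simp only [← h2, ← h3] at h1
  simp_rw [lintegral_indicator (hR _)] at h1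
  exact h1

/-- The truncation bound as a single integral over the positions of `d + 1` points: the tail is
the probability that the largest of them gets an index greater than `K`. -/
theorem truncationBound_eq (hEU : IsPoissonWithMarks P g E U)
    (hτ : Measurable (Function.uncurry τ)) {d K : ℕ} (hK : d < K) :
    truncationBound P h τ E U (d + 1) K =
      ∫⁻ γ, poissonTail (K - d) (Finset.univ.sup γ) * markIntegral h τ g γ
        ∂(lebesguePi (d + 1)) := by
  rw [← sum_lintegral_region_add_sum_lintegral_boundary hK (measurable_markIntegral hτ)
    markIntegral_comp_perm, truncationBound]
  congr 1
  · rw [Finset.range_eq_Ico, Finset.sum_eq_sum_Ico_succ_bot (by omega), tailTerm, truncationTerm]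
    congr 1
    · have h0 := lintegral_region_integrand (h := h) hEU hτ (d := d + 1) (ℓ := 0) (n := 0) (K := K)
        (by omega)
      simpa using h0
    · have hI : Finset.Ico (0 + 1) (d + 1) = Finset.Icc 1 (d + 1 - 1) := by ext; simp
      rw [hI]
      refine Finset.sum_congr rfl fun ℓ hℓ => ?_
      rw [lintegral_region_integrand hEU hτ (by simp at hℓ; omega)]
  · rw [boundaryTerm, Nat.add_sub_cancel]
    refine Finset.sum_congr rfl fun ℓ hℓ => ?_
    obtain ⟨j₀, rfl⟩ : ∃ j₀ : Fin (d + 1), (j₀ : ℕ) + 1 = ℓ := by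
      rw [Finset.mem_Icc] at hℓ
      exact ⟨⟨ℓ - 1, by omega⟩, Nat.sub_add_cancel hℓ.1⟩
    rw [lintegral_region_boundary_integrand hEU hτ (by simp at hℓ; omega)]
    congr 2
    funext G
    congr 2
    omega

/-- The truncation bound is the mean total of `-log π` over all edges that have a vertex beyond
the truncation. -/
theorem tsum_lintegral_negLogPi_eq_truncationBound (hEU : IsPoissonWithMarks P g E U)
    (hτ : Measurable (Function.uncurry τ)) {d K : ℕ} (hK : d < K) :
    ∑' i : Fin (d + 1) ↪ ℕ, (if ∃ j, K ≤ i j then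
        ∫⁻ ω, negLogPi h (edgeWeight (fun k => rate τ E U k ω) i) ∂P else 0) =
      truncationBound P h τ E U (d + 1) K := by
  rw [truncationBound_eq hEU hτ hK, ← tsum_embedding_arrival hEU hK.le (measurable_markIntegral hτ)
    markIntegral_comp_perm]
  refine tsum_congr fun i => ?_
  simp [Set.indicator, lintegral_negLogPi_rate hEU hτ]

/-- Integration over marks and positions is integration over rates, as positions whose rate
vanishes do not contribute. -/
lemma lintegral_markIntegral {ν : Measure ℝ≥0} [SigmaFinite ν]
    (hτ : IsSeriesRepresentation ν g τ) (hzero : h 0 {0} = 1) (d : ℕ) :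
    ∫⁻ γ, markIntegral h τ g γ ∂(lebesguePi d) =
      ∫⁻ θ : Fin d → ℝ≥0, negLogPi h (∏ j, θ j) ∂(Measure.pi fun _ => ν) := by
  set A : Set (ℝ≥0 × ℝ≥0) := Function.uncurry τ ⁻¹' Set.Ioi 0 with hA
  have hAm : MeasurableSet A := hτ.measurable measurableSet_Ioi
  have hprod : Measurable fun θ : Fin d → ℝ≥0 => negLogPi h (∏ j, θ j) := by fun_prop
  have hmp : MeasurePreserving (Function.uncurry τ) ((g.prod lebesgue).restrict A) ν :=
    ⟨hτ.measurable, by rw [← hτ.map_eq, Measure.restrict_map hτ.measurable measurableSet_Ioi]⟩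
  have h1 := (measurePreserving_pi (fun _ : Fin d => (g.prod lebesgue).restrict A) (fun _ => ν)
    (fun _ => hmp)).lintegral_comp hprod
  have h2 : MeasurableSet (Set.univ.pi fun _ : Fin d => A) := MeasurableSet.univ_pi fun _ => hAm
  rw [← h1, ← Measure.restrict_pi_pi, ← lintegral_indicator h2]
  have h3 := (measurePreserving_arrowProdEquivProdArrow ℝ≥0 ℝ≥0 (Fin d) (fun _ => g)
    (fun _ => lebesgue)).lintegral_comp (f := fun q : (Fin d → ℝ≥0) × (Fin d → ℝ≥0) =>
      negLogPi h (∏ j, τ (q.1 j) (q.2 j))) (measurable_negLogPi_prod hτ.measurable)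
  have h0 : negLogPi h 0 = 0 := by simp [negLogPi, hzero]
  calc ∫⁻ γ, markIntegral h τ g γ ∂(lebesguePi d)
      = ∫⁻ q, negLogPi h (∏ j, τ (q.1 j) (q.2 j))
          ∂((Measure.pi fun _ : Fin d => g).prod (Measure.pi fun _ : Fin d => lebesgue)) :=
        (lintegral_prod_symm' _ (measurable_negLogPi_prod hτ.measurable)).symm
    _ = _ := h3.symm
    _ = _ := by
        refine lintegral_congr fun w => ?_
        change negLogPi h (∏ j, τ (w j).1 (w j).2) = _
        by_cases hw : w ∈ Set.univ.pi fun _ : Fin d => A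
        · rw [Set.indicator_of_mem hw]; rfl
        · rw [Set.indicator_of_notMem hw]
          simp only [Set.mem_univ_pi, not_forall, hA, Set.mem_preimage, Set.mem_Ioi, not_lt,
            nonpos_iff_eq_zero] at hw
          obtain ⟨j, hj⟩ := hw
          rw [Finset.prod_eq_zero (Finset.mem_univ j) hj, h0]

/-- Jensen's inequality for the exponential function. -/
lemma exp_neg_lintegral_le {X : Ω → ℝ≥0∞} (hX : Measurable X) :
    EReal.exp (-((∫⁻ ω, X ω ∂P : ℝ≥0∞) : EReal)) ≤ ∫⁻ ω, EReal.exp (-(X ω : EReal)) ∂P := by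
  by_cases hm : ∫⁻ ω, X ω ∂P = ∞
  · simp [hm]
  obtain ⟨m, hm⟩ : ∃ m : ℝ≥0, ∫⁻ ω, X ω ∂P = m := ⟨_, (ENNReal.coe_toNNReal hm).symm⟩
  rw [hm]
  set c : ℝ≥0∞ := EReal.exp (-((m : ℝ≥0∞) : EReal)) with hc
  have hc' : c = ENNReal.ofReal (Real.exp (-m)) := by
    rw [hc, EReal.coe_nnreal_eq_coe_real, ← EReal.coe_neg, EReal.exp_coe]
  have hc0 : c ≠ 0 := by rw [hc']; simp [Real.exp_pos]
  have hct : c ≠ ∞ := by rw [hc']; exact ENNReal.ofReal_ne_top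
  -- the tangent to the exponential function at the mean `m`
  have hpt (x : ℝ≥0∞) : c + c * m ≤ EReal.exp (-(x : EReal)) + c * x := by
    induction x with
    | top => simp [ENNReal.mul_top hc0]
    | coe x =>
      rw [EReal.coe_nnreal_eq_coe_real, ← EReal.coe_neg, EReal.exp_coe, hc',
        ← ENNReal.ofReal_coe_nnreal, ← ENNReal.ofReal_coe_nnreal,
        ← ENNReal.ofReal_mul (by positivity), ← ENNReal.ofReal_mul (by positivity),
        ← ENNReal.ofReal_add (by positivity) (by positivity),
        ← ENNReal.ofReal_add (by positivity) (by positivity)]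
      refine ENNReal.ofReal_le_ofReal ?_
      have h1 := Real.add_one_le_exp ((m : ℝ) - x)
      have h2 : Real.exp (-(x : ℝ)) = Real.exp (-m) * Real.exp (m - x) := by
        rw [← Real.exp_add]; congr 1; ring
      rw [h2]
      nlinarith [Real.exp_pos (-(m : ℝ))]
  have h1 := lintegral_mono (μ := P) fun ω => hpt (X ω)
  rw [lintegral_const, measure_univ, mul_one, lintegral_add_right _ (hX.const_mul c),
    lintegral_const_mul _ hX, hm] at h1
  exact (ENNReal.add_le_add_iff_right (ENNReal.mul_ne_top hct ENNReal.coe_ne_top)).1 h1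

lemma exp_neg_negLogPi [IsMarkovKernel h] (ϑ : ℝ≥0) :
    EReal.exp (-(negLogPi h ϑ : EReal)) = h ϑ {0} := by
  have : 0 ≤ -ENNReal.log (h ϑ {0}) := by
    rw [EReal.neg_nonneg]
    exact ENNReal.log_le_zero_iff.2 prob_le_one
  rw [negLogPi, EReal.coe_toENNReal this, neg_neg, ENNReal.exp_log]

lemma exp_neg_sum {ι : Type*} (F : Finset ι) (X : ι → ℝ≥0∞) :
    EReal.exp (-((∑ p ∈ F, X p : ℝ≥0∞) : EReal)) = ∏ p ∈ F, EReal.exp (-(X p : EReal)) := by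
  classical
  induction F using Finset.induction_on with
  | empty => simp
  | insert a F ha ih =>
    rw [Finset.sum_insert ha, Finset.prod_insert ha, ← ih, ← EReal.exp_add, EReal.coe_ennreal_add,
      EReal.neg_add, sub_eq_add_neg] <;> simp

/-- A lower bound for the probability that none of the edges of a countable family occurs. -/
lemma exp_neg_tsum_le [IsMarkovKernel h] {d : ℕ} {θ : ℕ → Ω → ℝ≥0} (hθ : ∀ k, Measurable (θ k))
    {x : ℕ → (Fin d ↪ ℕ) → Ω → ℕ} (hx : IsIndependentLikelihood P h θ x)
    (T : Set (ℕ × (Fin d ↪ ℕ))) :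
    EReal.exp (-((∑' p : T, ∫⁻ ω, negLogPi h (edgeWeight (fun k => θ k ω) p.1.2) ∂P : ℝ≥0∞) :
      EReal)) ≤ P {ω | ∀ p ∈ T, x p.1 p.2 ω = 0} := by
  classical
  have hcount : Countable (Fin d ↪ ℕ) := DFunLike.coe_injective.countable
  have hset : {ω | ∀ p ∈ T, x p.1 p.2 ω = 0} =
      ⋂ F : Finset T, {ω | ∀ p ∈ F, x p.1.1 p.1.2 ω = 0} := by
    ext ω
    simp only [Set.mem_ofPred_eq, Set.mem_iInter]
    exact ⟨fun h F p _ => h p.1 p.2, fun h p hp =>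
      h {⟨p, hp⟩} ⟨p, hp⟩ (Finset.mem_singleton_self _)⟩
  have hms (F : Finset T) : MeasurableSet {ω | ∀ p ∈ F, x p.1.1 p.1.2 ω = 0} := by
    simp only [Set.ofPred_forall]
    exact .iInter fun p => .iInter fun _ => hx.measurable _ _ (.singleton 0)
  have hdir : Directed (· ⊇ ·) fun F : Finset T => {ω | ∀ p ∈ F, x p.1.1 p.1.2 ω = 0} :=
    fun F F' => ⟨F ∪ F', fun ω h p hp => h p (Finset.mem_union_left _ hp),
      fun ω h p hp => h p (Finset.mem_union_right _ hp)⟩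
  rw [hset, hdir.measure_iInter (fun F => (hms F).nullMeasurableSet) ⟨∅, measure_ne_top _ _⟩]
  refine le_iInf fun F => ?_
  have hmw (i : Fin d ↪ ℕ) : Measurable fun ω => negLogPi h (edgeWeight (fun k => θ k ω) i) := by
    unfold edgeWeight
    exact (measurable_negLogPi h).comp (Finset.measurable_fun_prod _ fun j _ => hθ _)
  have hF := hx.cond_law Set.univ MeasurableSet.univ
    (F.map (Function.Embedding.subtype _)) fun _ => 0
  simp only [Set.mem_univ, true_and, Finset.mem_map, Finset.prod_map, Set.ofPred_true,
    Measure.restrict_univ, Function.Embedding.subtype_apply, forall_exists_index, and_imp,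
    forall_apply_eq_imp_iff₂] at hF
  rw [hF]
  calc _ ≤ EReal.exp (-((∑ p ∈ F, ∫⁻ ω, negLogPi h (edgeWeight (fun k => θ k ω) p.1.2) ∂P :
        ℝ≥0∞) : EReal)) := by
        refine EReal.exp_monotone (EReal.neg_le_neg_iff.2 ?_)
        exact_mod_cast ENNReal.sum_le_tsum F
    _ = EReal.exp (-((∫⁻ ω, ∑ p ∈ F, negLogPi h (edgeWeight (fun k => θ k ω) p.1.2) ∂P :
        ℝ≥0∞) : EReal)) := by rw [lintegral_finsetSum _ fun p _ => hmw _]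
    _ ≤ ∫⁻ ω, EReal.exp (-((∑ p ∈ F, negLogPi h (edgeWeight (fun k => θ k ω) p.1.2) : ℝ≥0∞) :
        EReal)) ∂P := exp_neg_lintegral_le (Finset.measurable_fun_sum _ fun p _ => hmw _)
    _ = _ := by simp_rw [exp_neg_sum, exp_neg_negLogPi]

end

/-! ### Probability, finiteness and limit -/

section

lemma maxVertex_le_of_forall {Ω : Type*} {d N K : ℕ} {x : ℕ → (Fin d ↪ ℕ) → Ω → ℕ} {ω : Ω}
    (h : ∀ n < N, ∀ i : Fin d ↪ ℕ, (∃ j, K ≤ i j) → x n i ω = 0) : maxVertex x N ω ≤ K := by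
  refine iSup_le fun i => iSup_le fun hi => iSup_le fun j => ?_
  by_contra hlt
  have hK : K ≤ i j := by
    have h1 : (K : ℕ∞) < ((i j + 1 : ℕ) : ℕ∞) := by push_cast; exact not_le.1 hlt
    exact Nat.lt_succ_iff.1 (Nat.cast_lt.1 h1)
  refine hi.ne' (Finset.sum_eq_zero fun n hn => ?_)
  exact h n (Finset.mem_range.1 hn) i ⟨j, hK⟩

variable {Ω : Type*} [MeasurableSpace Ω] {P : Measure Ω} [IsProbabilityMeasure P]
  {h : Kernel ℝ≥0 ℕ} {τ : ℝ≥0 → ℝ≥0 → ℝ≥0} {g : Measure ℝ≥0} [IsProbabilityMeasure g]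
  {E U : ℕ → Ω → ℝ≥0}

lemma exp_neg_truncationBound_le [IsMarkovKernel h] (hEU : IsPoissonWithMarks P g E U)
    (hτ : Measurable (Function.uncurry τ)) {d : ℕ} {x : ℕ → (Fin (d + 1) ↪ ℕ) → Ω → ℕ}
    (hx : IsIndependentLikelihood P h (rate τ E U) x) (N : ℕ) {K : ℕ} (hK : d < K) :
    EReal.exp (-(((N : ℝ≥0∞) * truncationBound P h τ E U (d + 1) K : ℝ≥0∞) : EReal)) ≤
      P {ω | maxVertex x N ω ≤ (K : ℕ∞)} := by
  have hrate (k : ℕ) : Measurable (rate τ E U k) :=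
    hτ.comp ((hEU.measurable_mark k).prodMk (measurable_arrival hEU.measurable_gap (k + 1)))
  -- the counts that have to vanish: every round, and every edge beyond the truncation
  set T : Set (ℕ × (Fin (d + 1) ↪ ℕ)) := {p | p.1 < N ∧ ∃ j, K ≤ p.2 j} with hT
  have hsum : ∑' p : T, ∫⁻ ω, negLogPi h (edgeWeight (fun k => rate τ E U k ω) p.1.2) ∂P =
      (N : ℝ≥0∞) * truncationBound P h τ E U (d + 1) K := by
    rw [tsum_subtype T fun p => ∫⁻ ω, negLogPi h (edgeWeight (fun k => rate τ E U k ω) p.2) ∂P,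
      ENNReal.tsum_prod', ← tsum_lintegral_negLogPi_eq_truncationBound hEU hτ hK,
      tsum_eq_sum (s := Finset.range N)]
    · rw [← nsmul_eq_mul, ← Finset.card_range N, ← Finset.sum_const, Finset.card_range]
      refine Finset.sum_congr rfl fun n hn => tsum_congr fun i => ?_
      simp [hT, Set.indicator, Finset.mem_range.1 hn]
    · intro n hn
      refine ENNReal.tsum_eq_zero.2 fun i => Set.indicator_of_notMem (fun hp => hn ?_) _
      exact Finset.mem_range.2 hp.1
  rw [← hsum]
  refine (exp_neg_tsum_le hrate hx T).trans (measure_mono fun ω hω => ?_)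
  exact maxVertex_le_of_forall fun n hn i hi => hω (n, i) ⟨hn, hi⟩

lemma tendsto_truncationBound (hEU : IsPoissonWithMarks P g E U)
    (hτ : Measurable (Function.uncurry τ)) {d K₀ : ℕ} (hK₀ : d < K₀)
    (hfin : truncationBound P h τ E U (d + 1) K₀ < ∞) :
    Tendsto (fun K => truncationBound P h τ E U (d + 1) K) atTop (𝓝 0) := by
  have hF := measurable_markIntegral (h := h) (g := g) hτ (d := d + 1)
  rw [truncationBound_eq hEU hτ hK₀] at hfin
  rw [← tendsto_add_atTop_iff_nat K₀]
  simp_rw [fun K => truncationBound_eq (h := h) hEU hτ (show d < K + K₀ by omega)]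
  rw [← lintegral_zero (μ := lebesguePi (d + 1))]
  refine tendsto_lintegral_of_dominated_convergence _ (fun K => by fun_prop)
    (fun K => .of_forall fun γ => mul_le_mul_left
      (poissonTail_anti (show K₀ - d ≤ K + K₀ - d by omega) _) _) hfin.ne ?_
  filter_upwards [ae_lt_top (by fun_prop) hfin.ne] with γ hγ
  by_cases h0 : markIntegral h τ g γ = ∞
  · -- an infinite factor forces the dominating tail to vanish
    have h1 : poissonTail (K₀ - d) (Finset.univ.sup γ) = 0 := by
      by_contra hne
      rw [h0, ENNReal.mul_top hne] at hγ
      exact lt_irrefl _ hγ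
    have h2 (K : ℕ) : poissonTail (K + K₀ - d) (Finset.univ.sup γ) = 0 :=
      le_antisymm ((poissonTail_anti (by omega) _).trans h1.le) zero_le
    simp [h2]
  · have h1 : Tendsto (fun K => K + K₀ - d) atTop atTop :=
      tendsto_atTop_mono (fun K => show K ≤ K + K₀ - d by omega) tendsto_id
    have h2 := ENNReal.Tendsto.mul_const
      ((tendsto_poissonTail (Finset.univ.sup γ)).comp h1) (Or.inr h0)
    simpa using h2

end

end CRMNetwork

theorem mainTheorem1 {Ω : Type*} [MeasurableSpace Ω] (P : Measure Ω) [IsProbabilityMeasure P]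
    (d : ℕ) (hd : 1 < d)
    (ν : Measure ℝ≥0) [SigmaFinite ν] (hν : ν Set.univ = ∞)
    (g : Measure ℝ≥0) [IsProbabilityMeasure g] (τ : ℝ≥0 → ℝ≥0 → ℝ≥0)
    (hτ : CRMNetwork.IsSeriesRepresentation ν g τ)
    (h : Kernel ℝ≥0 ℕ) [IsMarkovKernel h] (hzero : h 0 {0} = 1)
    (hmean : ∫⁻ θ : Fin d → ℝ≥0, CRMNetwork.likelihoodMean h (∏ j, θ j)
      ∂(Measure.pi fun _ => ν) < ∞)
    (E U : ℕ → Ω → ℝ≥0) (hEU : CRMNetwork.IsPoissonWithMarks P g E U)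
    (x : ℕ → (Fin d ↪ ℕ) → Ω → ℕ)
    (hx : CRMNetwork.IsIndependentLikelihood P h (CRMNetwork.rate τ E U) x) :
    (∀ N K : ℕ, d ≤ K →
      EReal.exp (-(((N : ℝ≥0∞) * CRMNetwork.truncationBound P h τ E U d K : ℝ≥0∞) : EReal)) ≤
        P {ω | CRMNetwork.maxVertex x N ω ≤ (K : ℕ∞)}) ∧
    (∫⁻ θ : Fin d → ℝ≥0, CRMNetwork.negLogPi h (∏ j, θ j) ∂(Measure.pi fun _ => ν) < ∞ →
      ∀ K : ℕ, d ≤ K → CRMNetwork.truncationBound P h τ E U d K < ∞) ∧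
    ((∃ K : ℕ, d ≤ K ∧ CRMNetwork.truncationBound P h τ E U d K < ∞) →
      Tendsto (fun K : ℕ => CRMNetwork.truncationBound P h τ E U d K) atTop (𝓝 0)) := by
  obtain ⟨d, rfl⟩ : ∃ d', d = d' + 1 := ⟨d - 1, by omega⟩
  refine ⟨fun N K hK => CRMNetwork.exp_neg_truncationBound_le hEU hτ.measurable hx N hK,
    fun hfin K hK => ?_, fun ⟨K₀, hK₀, hfin⟩ =>
      CRMNetwork.tendsto_truncationBound hEU hτ.measurable hK₀ hfin⟩
  rw [CRMNetwork.truncationBound_eq hEU hτ.measurable hK]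
  refine lt_of_le_of_lt (lintegral_mono fun γ => ?_)
    ((CRMNetwork.lintegral_markIntegral (g := g) hτ hzero (d + 1)).trans_lt hfin)
  exact (mul_le_mul_left (CRMNetwork.poissonTail_le_one _ _) _).trans (one_mul _).le
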